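/- All spaces are Hausdorff; a continuum is a non-empty connected compact space; maps are continuous. A map $f\colon Z\to X$ is \emph{ring-like} if for every $z\in Z$ and all open sets $U\ni z$, $V\ni f(z)$ there is an open set $V'$ with $f(z)\in V'\subset V$ and $f^{-1}(\operatorname{Fr}V')\subset U$. It is \emph{fully closed} if for all disjoint closed sets $F,G\subset Z$ the intersection $f(F)\cap f(G)$ is a discrete subspace of $X$. Put $\dim f=\sup\{\dim f^{-1}x: x\in X\}$ and $\operatorname{Ind} f=\sup\{\operatorname{Ind} f^{-1}x: x\in X\}$, where $\dim$ is the covering dimension and $\operatorname{Ind}$ the large inductive dimension. A continuum is \emph{decomposable} if it is the union of two proper subcontinua; it is \emph{hereditarily decomposable} if each of its non-degenerate subcontinua is decomposable, and \emph{hereditarily indecomposable} if none of its subcontinua is decomposable. \textbf{Theorem.} Let $X$ be a first countable continuum, and for every $x\in X$ let $Y_x$ be a metrizable continuum. Then there exist a first countable continuum $Z=Z(X,Y_x)$ and a map $\pi\colon Z\to X$ such that (a) for every $x\in X$ the pre-image $\pi^{-1}x$ is homeomorphic to $Y_x$; and (b) $\pi$ is ring-like and fully closed. Moreover, for every continuum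 $Z$ and every map $\pi\colon Z\to X$, the conjunction of (a) and (b) implies that (c) $\dim Z=\max\{\dim X,\dim\pi\}$; (d) if $X$ is perfectly normal, then $\operatorname{Ind} Z\le \operatorname{Ind} X+\operatorname{Ind}\pi$; (e) if $X$ is separable, then so is $Z$; (f) if all $Y_x$ are non-degenerate and $P\subset Z$ is a metrizable continuum, then the image $\pi(P)$ is a single point; and (g) if $X$ and all $Y_x$ are hereditarily indecomposable, then so is $Z$; and if $X$ and all $Y_x$ are hereditarily decomposable, then so is $Z$. -/

import Mathlib

open Set Topology

universe u v w

namespace RingLikeResolution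

section Continua

variable {X : Type u} [TopologicalSpace X]

/-- A subset of a space that is a continuum (non-empty, compact, connected). -/
def IsContinuum (s : Set X) : Prop :=
  IsCompact s ∧ IsConnected s

/-- The set is the union of two proper subcontinua. -/
def IsDecomposable (s : Set X) : Prop :=
  ∃ A B : Set X, IsContinuum A ∧ IsContinuum B ∧ A ⊂ s ∧ B ⊂ s ∧ A ∪ B = s

variable (X) in
/-- Every non-degenerate subcontinuum is decomposable. -/
def HereditarilyDecomposable : Prop :=
  ∀ P : Set X, IsContinuum P → P.Nontrivial → IsDecomposable P

variable (X) in
/-- No subcontinuum is decomposable. -/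
def HereditarilyIndecomposable : Prop :=
  ∀ P : Set X, IsContinuum P → ¬ IsDecomposable P

end Continua

section Maps

variable {X : Type u} {Y : Type v} [TopologicalSpace X] [TopologicalSpace Y]

/-- Ring-like maps: arbitrarily small neighbourhoods of `f x` have boundaries whose pre-images lie
in a given neighbourhood of `x`. -/
def IsRingLike (f : X → Y) : Prop :=
  ∀ (x : X) (U : Set X) (V : Set Y), IsOpen U → x ∈ U → IsOpen V → f x ∈ V →
    ∃ V' : Set Y, IsOpen V' ∧ f x ∈ V' ∧ V' ⊆ V ∧ f ⁻¹' frontier V' ⊆ U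

/-- Fully closed maps: images of disjoint closed sets meet in a discrete subspace. -/
def IsFullyClosed (f : X → Y) : Prop :=
  ∀ F G : Set X, IsClosed F → IsClosed G → Disjoint F G → IsDiscrete (f '' F ∩ f '' G)

end Maps

section Dimensions

/-- Covering dimension `< k`: every finite open cover has a finite open refinement such that no
point lies in more than `k` of its members. -/
def CoveringDimLT (X : Type u) [TopologicalSpace X] (k : ℕ) : Prop :=
  ∀ 𝒰 : Set (Set X), 𝒰.Finite → (∀ U ∈ 𝒰, IsOpen U) → ⋃₀ 𝒰 = univ →
    ∃ 𝒱 : Set (Set X), 𝒱.Finite ∧ (∀ V ∈ 𝒱, IsOpen V) ∧ ⋃₀ 𝒱 = univ ∧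
      (∀ V ∈ 𝒱, ∃ U ∈ 𝒰, V ⊆ U) ∧ ∀ x : X, {V ∈ 𝒱 | x ∈ V}.encard ≤ k

/-- The covering dimension `dim`, where `⊥` stands for `-1`. -/
noncomputable def coveringDim (X : Type u) [TopologicalSpace X] : WithBot ℕ∞ :=
  sInf {n | ∀ k : ℕ, n < k → CoveringDimLT X k}

/-- `L` is a partition in the space between `A` and `B`. -/
def IsPartitionBetween {X : Type u} [TopologicalSpace X] (L A B : Set X) : Prop :=
  ∃ U V : Set X, IsOpen U ∧ IsOpen V ∧ Disjoint U V ∧ Lᶜ = U ∪ V ∧ A ⊆ U ∧ B ⊆ V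

/-- Large inductive dimension `< k`: the space is empty if `k = 0`; if `k = n + 1`, any two
disjoint closed sets can be separated by a partition of large inductive dimension `< n`. -/
def LargeIndLT : ℕ → (X : Type u) → [TopologicalSpace X] → Prop
  | 0, X, _ => IsEmpty X
  | n + 1, X, _ => ∀ A B : Set X, IsClosed A → IsClosed B → Disjoint A B →
      ∃ L : Set X, IsPartitionBetween L A B ∧ LargeIndLT n L

/-- The large inductive dimension `Ind`, where `⊥` stands for `-1`. -/
noncomputable def largeInd (X : Type u) [TopologicalSpace X] : WithBot ℕ∞ :=
  sInf {n | ∀ k : ℕ, n < k → LargeIndLT k X}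

/-- The fibrewise covering dimension of a map. -/
noncomputable def mapCoveringDim {X : Type u} {Y : Type v} [TopologicalSpace X]
    (f : X → Y) : WithBot ℕ∞ :=
  ⨆ y : Y, coveringDim (f ⁻¹' {y})

/-- The fibrewise large inductive dimension of a map. -/
noncomputable def mapLargeInd {X : Type u} {Y : Type v} [TopologicalSpace X]
    (f : X → Y) : WithBot ℕ∞ :=
  ⨆ y : Y, largeInd (f ⁻¹' {y})

end Dimensions

end RingLikeResolution

/-!
# Ring-like fully closed maps onto first countable continua

**Existence.** Embed each `Y x` in the Banach space of bounded sequences, as a compact connected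
set `S x`. There is a path `p` on the half-line which spirals towards `S x`
(`exists_continuous_spiral`). As `X` is first countable, `x` is the zero set of a continuous
function `g`, and `h x a = p (1 / g a)` defines a map `h x` on the complement of `x` whose cluster
set at `x` is `S x`. The resolution `Z` consists of the pairs of a point `a` and a family with
coordinates `h x a` for `x ≠ a`, and with a coordinate in `S a` for `x = a`. A neighbourhood base at
a point over `a` is given by the projection and the coordinate with index `a` alone. This yields
first countability and full closedness; as `p` takes values near each point of `S a` arbitrarily
late, the boundaries of the sets `{g < t}` witness that the projection is ring-like.

**Properties.** Let `π` be any ring-like fully closed map with fibres `Y x`.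

* By compactness, full closedness says that the images of disjoint closed sets have a *finite*
  intersection. In terms of covers: given a finite open cover of `Z`, all but finitely many fibres
  lie in one of its members (`IsFullyClosed.finite_setOf_notMem_kernImage`).
* A subcontinuum of `Z` that is not contained in a fibre is a union of fibres
  (`IsRingLike.preimage_image_eq_of_isConnected`). Hence the statements on indecomposability and
  decomposability. A metrizable subcontinuum meets only countably many fibres in more than one point
  (`IsFullyClosed.countable_nontrivial_fibres`), whereas a non-degenerate image in `X` is
  uncountable.
* The equality for the covering dimension follows by modifying covers near the finitely many
  exceptional fibres, over neighbourhoods whose boundaries lie under one member of the cover.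
* For the large inductive dimension, the sum and open subspace theorems in perfectly normal spaces
  are proved first (`indLT_of_subset_iUnion`, `IndLT.inter_isOpen`). Given disjoint closed sets `A`
  and `B` of `Z`, their images meet in a finite set `D`. Collapsing the fibres off `D` to points
  gives a perfectly normal space, in which partitions of the fibres over `D` can be completed by the
  preimage of a partition in the complement of `D` (`exists_partition_of_isFullyClosed`).
-/

namespace RingLikeResolution

/-! ### Fully closed maps -/

section FullyClosed

variable {X : Type u} {Z : Type w} [TopologicalSpace X] [TopologicalSpace Z]

theorem IsFullyClosed.finite_image_inter_image [CompactSpace Z] [T2Space X] {π : Z → X}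
    (hπ : Continuous π) (hfc : IsFullyClosed π) {F G : Set Z} (hF : IsClosed F) (hG : IsClosed G)
    (hFG : Disjoint F G) : (π '' F ∩ π '' G).Finite :=
  ((hF.isCompact.image hπ).inter (hG.isCompact.image hπ)).finite (hfc F G hF hG hFG)

/-- The full closedness of `π` in terms of covers: all but finitely many fibres are contained in
some member of a given finite open cover. -/
theorem IsFullyClosed.finite_setOf_notMem_kernImage [CompactSpace Z] [T2Space Z] [T2Space X]
    {π : Z → X} (hπ : Continuous π) (hsurj : Function.Surjective π) (hfc : IsFullyClosed π)
    {ι : Type*} [Finite ι] {U : ι → Set Z} (hU : ∀ i, IsOpen (U i)) (hcov : ⋃ i, U i = univ) :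
    {x | ∀ i, x ∉ kernImage π (U i)}.Finite := by
  obtain ⟨C, hCcov, -, hCU⟩ := exists_subset_iUnion_closure_subset (s := univ) isClosed_univ hU
    (fun x _ => toFinite _) hcov.ge
  refine (finite_iUnion fun i => hfc.finite_image_inter_image hπ (isClosed_closure (s := C i))
    (hU i).isClosed_compl (disjoint_compl_right_iff_subset.2 (hCU i))).subset ?_
  intro x hx
  obtain ⟨z, rfl⟩ := hsurj x
  obtain ⟨i, hi⟩ := mem_iUnion.1 (hCcov (mem_univ z))
  refine mem_iUnion.2 ⟨i, mem_image_of_mem _ (subset_closure hi), ?_⟩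
  have := hx i
  simp only [kernImage, mem_ofPred_eq, not_forall] at this
  obtain ⟨z', h1, h2⟩ := this
  exact ⟨z', h2, h1⟩

theorem isOpen_kernImage [CompactSpace Z] [T2Space X] {π : Z → X} (hπ : Continuous π) {U : Set Z}
    (hU : IsOpen U) : IsOpen (kernImage π U) :=
  isClosedMap_iff_kernImage.1 hπ.isClosedMap hU

end FullyClosed

/-! ### Connected sets and ring-like maps -/

section RingLike

theorem IsPreconnected.inter_frontier_nonempty {X : Type u} [TopologicalSpace X] {s V : Set X}
    (hs : IsPreconnected s) (hV : IsOpen V) (h₁ : (s ∩ V).Nonempty) (h₂ : (s ∩ Vᶜ).Nonempty) :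
    (s ∩ frontier V).Nonempty := by
  rw [hV.frontier_eq]
  by_contra hempty
  have hcov : s ⊆ V ∪ (closure V)ᶜ := fun x hx => by
    by_contra hxV
    rw [mem_union, not_or, notMem_compl_iff] at hxV
    exact hempty ⟨x, hx, hxV.2, hxV.1⟩
  obtain ⟨x, hx, hxV⟩ := h₂
  obtain ⟨y, -, hy, hy'⟩ := hs _ _ hV isClosed_closure.isOpen_compl hcov h₁
    ⟨x, hx, (hcov hx).resolve_left hxV⟩
  exact hy' (subset_closure hy)

variable {X : Type u} {Z : Type w} [TopologicalSpace X] [TopologicalSpace Z] {π : Z → X}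

/-- A connected set which a ring-like map does not send to a point is a union of fibres: if it
missed a point `z` of a fibre over its image, then a small neighbourhood of `π z`, with boundary
disjoint from the image, would disconnect the image. -/
theorem IsRingLike.preimage_image_eq_of_isConnected [T2Space X] (hπ : Continuous π)
    (hr : IsRingLike π) {P : Set Z} (hPc : IsClosed P) (hP : IsConnected P)
    (hnt : (π '' P).Nontrivial) : π ⁻¹' (π '' P) = P := by
  refine Subset.antisymm (fun z hz => ?_) (subset_preimage_image π P)
  by_contra hzP
  obtain ⟨y, hy, hne⟩ := hnt.exists_ne (π z)
  obtain ⟨V, V₂, hV, hV₂, hzV, hyV₂, hdisj⟩ := t2_separation hne.symm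
  obtain ⟨V', hV', hzV', hV'V, hfr⟩ := hr z Pᶜ V hPc.isOpen_compl hzP hV hzV
  have hconn : IsPreconnected (π '' P) := hP.isPreconnected.image π hπ.continuousOn
  obtain ⟨x, ⟨p, hp, rfl⟩, hx⟩ :=
    IsPreconnected.inter_frontier_nonempty hconn hV' ⟨_, hz, hzV'⟩
      ⟨y, hy, fun h => disjoint_left.1 hdisj (hV'V h) hyV₂⟩
  exact hfr hx hp

/-- Open sets contain the fibres over a nonempty open set (unless the image is a point). -/
theorem IsRingLike.kernImage_nonempty [T2Space X] [ConnectedSpace X] [Nontrivial X]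
    (hr : IsRingLike π) {U : Set Z} (hU : IsOpen U) (hne : U.Nonempty) :
    (kernImage π U).Nonempty := by
  obtain ⟨z, hz⟩ := hne
  obtain ⟨y, hy⟩ := exists_ne (π z)
  obtain ⟨V, V₂, hV, hV₂, hzV, hyV₂, hdisj⟩ := t2_separation hy.symm
  obtain ⟨V', hV', hzV', hV'V, hfr⟩ := hr z U V hU hz hV hzV
  obtain ⟨x, -, hx⟩ := IsPreconnected.inter_frontier_nonempty (isPreconnected_univ (α := X)) hV'
    ⟨_, trivial, hzV'⟩ ⟨y, trivial, fun h => disjoint_left.1 hdisj (hV'V h) hyV₂⟩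
  exact ⟨x, fun a ha => hfr (show π a ∈ _ from ha ▸ hx)⟩

theorem IsRingLike.separableSpace [CompactSpace Z] [T2Space X] [ConnectedSpace X]
    (hπ : Continuous π) (hsurj : Function.Surjective π) (hr : IsRingLike π)
    (hfib : ∀ x, TopologicalSpace.SeparableSpace (π ⁻¹' {x} : Set Z))
    [TopologicalSpace.SeparableSpace X] : TopologicalSpace.SeparableSpace Z := by
  rcases subsingleton_or_nontrivial X with hX | hX
  · obtain ⟨x⟩ := (inferInstance : Nonempty X)
    have huniv : (π ⁻¹' {x} : Set Z) = univ := eq_univ_of_forall fun z => Subsingleton.elim _ _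
    have := hfib x
    rw [huniv] at this
    exact (Homeomorph.Set.univ Z).surjective.denseRange.separableSpace
      (Homeomorph.Set.univ Z).continuous
  · obtain ⟨D, hDc, hD⟩ := TopologicalSpace.exists_countable_dense X
    choose σ hσ using hsurj
    refine ⟨⟨σ '' D, hDc.image σ, dense_iff_inter_open.2 fun U hU hne => ?_⟩⟩
    obtain ⟨x, hx, hxD⟩ := dense_iff_inter_open.1 hD _ (isOpen_kernImage hπ hU)
      (hr.kernImage_nonempty hU hne)
    exact ⟨σ x, hx (hσ x), mem_image_of_mem _ hxD⟩

end RingLike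

/-! ### Decomposability of subcontinua -/

section Subcontinua

variable {X : Type u} {Y : Type v} {Z : Type w} [TopologicalSpace X] [TopologicalSpace Y]
  [TopologicalSpace Z] {π : Z → X}

theorem IsContinuum.image {P : Set Z} (hP : IsContinuum P) (hπ : Continuous π) :
    IsContinuum (π '' P) :=
  ⟨hP.1.image hπ, hP.2.image π hπ.continuousOn⟩

theorem IsContinuum.preimage [CompactSpace Z] [T2Space X] (hπ : Continuous π)
    (hfib : ∀ x, IsConnected (π ⁻¹' {x})) {A : Set X} (hA : IsContinuum A) :
    IsContinuum (π ⁻¹' A) := by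
  have hsurj : Function.Surjective π := fun x => (hfib x).nonempty
  exact ⟨(hA.1.isClosed.preimage hπ).isCompact,
    (hπ.isClosedMap.isQuotientMap hπ hsurj).isCoinducing.isConnected_preimage_of_isClosed hfib
      hA.1.isClosed hA.2⟩

theorem isContinuum_image_iff {e : Y → Z} (he : IsEmbedding e) {P : Set Y} :
    IsContinuum (e '' P) ↔ IsContinuum P := by
  refine and_congr he.isCompact_iff.symm ?_
  rw [IsConnected, IsConnected, image_nonempty, he.isInducing.isPreconnected_image]

theorem IsDecomposable.image {e : Y → Z} (he : IsEmbedding e) {P : Set Y}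
    (h : IsDecomposable P) : IsDecomposable (e '' P) := by
  obtain ⟨A, B, hA, hB, hAP, hBP, rfl⟩ := h
  exact ⟨e '' A, e '' B, (isContinuum_image_iff he).2 hA, (isContinuum_image_iff he).2 hB,
    (he.injective.injOn.image_ssubset_image_iff (subset_univ _) (subset_univ _)).2 hAP,
    (he.injective.injOn.image_ssubset_image_iff (subset_univ _) (subset_univ _)).2 hBP,
    (image_union ..).symm⟩

theorem IsDecomposable.of_image {e : Y → Z} (he : IsEmbedding e) {P : Set Y}
    (h : IsDecomposable (e '' P)) : IsDecomposable P := by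
  obtain ⟨A, B, hA, hB, hAP, hBP, hAB⟩ := h
  obtain ⟨A, rfl⟩ := subset_range_iff_exists_image_eq.1 (hAP.subset.trans (image_subset_range e P))
  obtain ⟨B, rfl⟩ := subset_range_iff_exists_image_eq.1 (hBP.subset.trans (image_subset_range e P))
  rw [← image_union] at hAB
  exact ⟨A, B, (isContinuum_image_iff he).1 hA, (isContinuum_image_iff he).1 hB,
    (he.injective.injOn.image_ssubset_image_iff (subset_univ _) (subset_univ _)).1 hAP,
    (he.injective.injOn.image_ssubset_image_iff (subset_univ _) (subset_univ _)).1 hBP,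
    he.injective.image_injective hAB⟩

theorem exists_embedding_image_eq {X : Type u} {π : Z → X} {x : X}
    (φ : (π ⁻¹' {x} : Set Z) ≃ₜ Y) {P : Set Z} (hP : π '' P ⊆ {x}) :
    ∃ (e : Y → Z) (P' : Set Y), IsEmbedding e ∧ e '' P' = P := by
  refine ⟨fun y => (φ.symm y : Z), (fun y => (φ.symm y : Z)) ⁻¹' P,
    IsEmbedding.subtypeVal.comp φ.symm.isEmbedding, ?_⟩
  rw [image_preimage_eq_iff]
  intro z hz
  exact ⟨φ ⟨z, hP (mem_image_of_mem _ hz)⟩, by simp⟩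

theorem hereditarilyIndecomposable_of_isRingLike {Y : X → Type v} [∀ x, TopologicalSpace (Y x)]
    [T2Space Z] [T2Space X] (hπ : Continuous π)
    (φ : ∀ x, (π ⁻¹' {x} : Set Z) ≃ₜ Y x) (hr : IsRingLike π)
    (hX : HereditarilyIndecomposable X) (hY : ∀ x, HereditarilyIndecomposable (Y x)) :
    HereditarilyIndecomposable Z := by
  intro P hP hdec
  rcases (π '' P).subsingleton_or_nontrivial with hs | hnt
  · obtain ⟨x, hx⟩ := hP.2.nonempty.image π
    obtain ⟨e, P', he, rfl⟩ := exists_embedding_image_eq (φ x)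
      (fun y hy => hs hy hx : π '' P ⊆ {x})
    exact hY x P' ((isContinuum_image_iff he).1 hP) (hdec.of_image he)
  · obtain ⟨A, B, hA, hB, hAP, hBP, rfl⟩ := hdec
    -- A subcontinuum with the same image as the whole continuum is a union of fibres.
    have key : ∀ C : Set Z, IsContinuum C → C ⊂ A ∪ B → π '' C ⊂ π '' (A ∪ B) := by
      refine fun C hC hCP => (image_mono hCP.subset).ssubset_of_ne fun heq => hCP.ne ?_
      rw [← hr.preimage_image_eq_of_isConnected hπ hC.1.isClosed hC.2 (heq ▸ hnt), heq,
        hr.preimage_image_eq_of_isConnected hπ hP.1.isClosed hP.2 hnt]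
    exact hX _ (hP.image hπ) ⟨_, _, hA.image hπ, hB.image hπ, key A hA hAP, key B hB hBP,
      (image_union ..).symm⟩

theorem hereditarilyDecomposable_of_isRingLike {Y : X → Type v} [∀ x, TopologicalSpace (Y x)]
    [CompactSpace Z] [T2Space Z] [T2Space X] (hπ : Continuous π)
    (φ : ∀ x, (π ⁻¹' {x} : Set Z) ≃ₜ Y x) (hfib : ∀ x, IsConnected (π ⁻¹' {x}))
    (hr : IsRingLike π)
    (hX : HereditarilyDecomposable X) (hY : ∀ x, HereditarilyDecomposable (Y x)) :
    HereditarilyDecomposable Z := by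
  intro P hP hPnt
  rcases (π '' P).subsingleton_or_nontrivial with hs | hnt
  · obtain ⟨x, hx⟩ := hP.2.nonempty.image π
    obtain ⟨e, P', he, rfl⟩ := exists_embedding_image_eq (φ x)
      (fun y hy => hs hy hx : π '' P ⊆ {x})
    exact (hY x P' ((isContinuum_image_iff he).1 hP) (nontrivial_of_image e P' hPnt)).image he
  · have hsurj : Function.Surjective π := fun x => (hfib x).nonempty
    obtain ⟨A, B, hA, hB, hAP, hBP, hAB⟩ := hX _ (hP.image hπ) hnt
    rw [← hr.preimage_image_eq_of_isConnected hπ hP.1.isClosed hP.2 hnt]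
    have key : ∀ {C D : Set X}, C ⊂ D → π ⁻¹' C ⊂ π ⁻¹' D := fun h =>
      (preimage_mono h.subset).ssubset_of_ne fun heq => h.ne (hsurj.preimage_injective heq)
    exact ⟨_, _, hA.preimage hπ hfib, hB.preimage hπ hfib, key hAP, key hBP,
      by rw [← preimage_union, hAB]⟩

end Subcontinua

/-! ### Metrizable subcontinua -/

section MetrizableSubcontinua

variable {X : Type u} {Z : Type w} [TopologicalSpace X] [TopologicalSpace Z] {π : Z → X}

theorem IsPreconnected.subsingleton_of_countable [CompletelyRegularSpace X] [T1Space X]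
    {s : Set X} (hs : IsPreconnected s) (hc : s.Countable) : s.Subsingleton := by
  intro x hx y hy
  by_contra hne
  obtain ⟨f, hf, hfx, hfy⟩ := CompletelyRegularSpace.completely_regular x {y} isClosed_singleton
    (by simpa using hne)
  have hsub := (hc.image fun z => (f z : ℝ)).isTotallyDisconnected _ Subset.rfl
    (hs.image _ (by fun_prop))
  have := hsub (mem_image_of_mem _ hx) (mem_image_of_mem _ hy)
  simp [hfx, hfy (mem_singleton y)] at this

/-- A fully closed map identifies pairs of distinct points of a compact metrizable set over
countably many points only. -/
theorem IsFullyClosed.countable_nontrivial_fibres [CompactSpace Z] [T2Space Z] [T2Space X]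
    (hπ : Continuous π) (hfc : IsFullyClosed π) {P : Set Z} (hP : IsClosed P)
    [SecondCountableTopology P] :
    {x | (P ∩ π ⁻¹' {x}).Nontrivial}.Countable := by
  have : CompactSpace P := isCompact_iff_compactSpace.1 hP.isCompact
  -- There are only countably many pairs of basic sets with disjoint closures, and each pair
  -- accounts for finitely many points `x`.
  have hb := TopologicalSpace.isBasis_countableBasis P
  let cl : Set P → Set Z := fun s => Subtype.val '' closure s
  have hcl : ∀ s, IsClosed (cl s) := fun s => hP.isClosedMap_subtype_val _ isClosed_closure
  refine (((TopologicalSpace.countable_countableBasis P).prod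
    (TopologicalSpace.countable_countableBasis P)).mono
    (inter_subset_left (t := {p | Disjoint (cl p.1) (cl p.2)}))).biUnion
    (t := fun p _ => π '' cl p.1 ∩ π '' cl p.2)
    (fun p hp => (hfc.finite_image_inter_image hπ (hcl _) (hcl _) hp.2).countable) |>.mono ?_
  rintro x ⟨z, ⟨hz, hzx⟩, z', ⟨hz', hzx'⟩, hne⟩
  obtain ⟨U, hU, V, hV, hUV⟩ : ∃ U ∈ 𝓝 (⟨z, hz⟩ : P), ∃ V ∈ 𝓝 (⟨z', hz'⟩ : P),
      Disjoint (closure U) (closure V) :=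
    exists_nhds_disjoint_closure (by simpa using hne)
  obtain ⟨U', hU'b, hzU', hU'U⟩ := hb.mem_nhds_iff.1 hU
  obtain ⟨V', hV'b, hzV', hV'V⟩ := hb.mem_nhds_iff.1 hV
  refine mem_biUnion (x := (U', V')) ⟨⟨hU'b, hV'b⟩, ?_⟩
    ⟨⟨z, mem_image_of_mem _ (subset_closure hzU'), hzx⟩,
      ⟨z', mem_image_of_mem _ (subset_closure hzV'), hzx'⟩⟩
  exact (disjoint_image_iff Subtype.val_injective).2
    (hUV.mono (closure_mono hU'U) (closure_mono hV'V))

theorem exists_image_eq_singleton_of_metrizable [CompactSpace Z] [T2Space Z] [CompactSpace X]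
    [T2Space X] (hπ : Continuous π) (hfib : ∀ x, (π ⁻¹' {x}).Nontrivial) (hr : IsRingLike π)
    (hfc : IsFullyClosed π) {P : Set Z} (hP : IsContinuum P)
    [TopologicalSpace.MetrizableSpace P] : ∃ x, π '' P = {x} := by
  have : CompactSpace P := isCompact_iff_compactSpace.1 hP.1
  let _ := TopologicalSpace.metrizableSpaceMetric P
  have hsub : (π '' P).Subsingleton := by
    rw [← not_nontrivial_iff]
    intro hnt
    have heq := hr.preimage_image_eq_of_isConnected hπ hP.1.isClosed hP.2 hnt
    refine not_nontrivial_iff.2 (IsPreconnected.subsingleton_of_countable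
      (hP.image hπ).2.isPreconnected ((hfc.countable_nontrivial_fibres hπ hP.1.isClosed).mono
        fun x hx => ?_)) hnt
    have : π ⁻¹' {x} ⊆ P := by
      rw [← heq]
      exact preimage_mono (singleton_subset_iff.2 hx)
    simpa [inter_eq_self_of_subset_right this] using hfib x
  exact hsub.eq_empty_or_singleton.resolve_left (hP.2.nonempty.image π).ne_empty

end MetrizableSubcontinua

end RingLikeResolution

/-! ### Covering dimension -/

namespace RingLikeResolution

section CoveringDimension

variable {X : Type u} {Z : Type w} [TopologicalSpace X] [TopologicalSpace Z]

theorem CoveringDimLT.exists_shrink {e : X → Z} (he : IsInducing e) {k : ℕ}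
    (h : CoveringDimLT X k) {ι : Type*} [Finite ι] {U : ι → Set Z} (hU : ∀ i, IsOpen (U i))
    (hcov : range e ⊆ ⋃ i, U i) :
    ∃ V : ι → Set Z, (∀ i, IsOpen (V i)) ∧ (∀ i, V i ⊆ U i) ∧ range e ⊆ ⋃ i, V i ∧
      ∀ x, {i | e x ∈ V i}.encard ≤ k := by
  obtain ⟨𝒱, -, hop, hcov', href, hord⟩ := h (range fun i => e ⁻¹' U i) (finite_range _)
    (forall_mem_range.2 fun i => (hU i).preimage he.continuous)
    (by rw [sUnion_range, ← preimage_iUnion, preimage_eq_univ_iff]; exact hcov)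
  simp only [exists_range_iff] at href
  choose idx hidx using href
  have hO : ∀ i, ∃ O, IsOpen O ∧ e ⁻¹' O = ⋃₀ {V | ∃ hV : V ∈ 𝒱, idx V hV = i} := fun i =>
    he.isOpen_iff.1 (isOpen_sUnion fun V hV => hop V hV.1)
  choose O hOo hOeq using hO
  refine ⟨fun i => O i ∩ U i, fun i => (hOo i).inter (hU i), fun i => inter_subset_right, ?_,
    fun x => ?_⟩
  · rintro _ ⟨x, rfl⟩
    obtain ⟨V, hV, hxV⟩ := mem_sUnion.1 (hcov'.ge (mem_univ x))
    refine mem_iUnion.2 ⟨idx V hV, ?_, hidx V hV hxV⟩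
    exact (hOeq (idx V hV)).ge ⟨V, ⟨hV, rfl⟩, hxV⟩
  · let f : {V ∈ 𝒱 | x ∈ V} → ι := fun V => idx V.1 V.2.1
    have hsub : {i | e x ∈ O i ∩ U i} ⊆ f '' univ := by
      rintro i ⟨hi, -⟩
      obtain ⟨V, ⟨hV, rfl⟩, hxV⟩ := (hOeq i).le hi
      exact ⟨⟨V, hV, hxV⟩, trivial, rfl⟩
    calc _ ≤ (f '' univ).encard := encard_le_encard hsub
      _ ≤ (univ : Set {V ∈ 𝒱 | x ∈ V}).encard := encard_image_le f univ
      _ = {V ∈ 𝒱 | x ∈ V}.encard := by rw [encard_univ]; rfl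
      _ ≤ k := hord x

theorem coveringDimLT_of_exists_refinement {k : ℕ}
    (h : ∀ (ι : Type u) [Finite ι] (U : ι → Set X), (∀ i, IsOpen (U i)) → ⋃ i, U i = univ →
      ∃ (κ : Type v) (_ : Finite κ) (V : κ → Set X), (∀ j, IsOpen (V j)) ∧
        (∀ j, ∃ i, V j ⊆ U i) ∧ ⋃ j, V j = univ ∧ ∀ x, {j | x ∈ V j}.encard ≤ k) :
    CoveringDimLT X k := by
  intro 𝒰 hfin hop hcov
  have : Finite 𝒰 := hfin
  obtain ⟨κ, _, V, hV, href, hVcov, hord⟩ := h 𝒰 (fun U => U) (fun U => hop U U.2)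
    (by rw [← sUnion_eq_iUnion, hcov])
  refine ⟨range V, finite_range V, forall_mem_range.2 hV, by rw [sUnion_range, hVcov],
    forall_mem_range.2 fun j => ?_, fun x => ?_⟩
  · obtain ⟨U, hU⟩ := href j
    exact ⟨U, U.2, hU⟩
  · refine le_trans (encard_le_encard ?_) ((encard_image_le V _).trans (hord x))
    rintro _ ⟨⟨j, rfl⟩, hx⟩
    exact ⟨j, hx, rfl⟩

theorem CoveringDimLT.of_isClosedEmbedding {e : X → Z} (he : IsClosedEmbedding e) {k : ℕ}
    (h : CoveringDimLT Z k) : CoveringDimLT X k := by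
  refine coveringDimLT_of_exists_refinement fun ι _ U hU hcov => ?_
  choose O hO hOU using fun i => he.isInducing.isOpen_iff.1 (hU i)
  obtain ⟨V, hVo, hVO, hVcov, hord⟩ := h.exists_shrink (e := id) IsInducing.id
    (U := fun o : Option ι => o.elim (range e)ᶜ O)
    (Option.forall.2 ⟨he.isClosed_range.isOpen_compl, hO⟩) (by
      rintro z -
      by_cases hz : z ∈ range e
      · obtain ⟨x, rfl⟩ := hz
        obtain ⟨i, hi⟩ := mem_iUnion.1 (hcov.ge (mem_univ x))
        exact mem_iUnion.2 ⟨some i, (hOU i).ge hi⟩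
      · exact mem_iUnion.2 ⟨none, hz⟩)
  refine ⟨ι, inferInstance, fun i => e ⁻¹' V (some i), fun i => (hVo _).preimage he.continuous,
    fun i => ⟨i, (preimage_mono (hVO (some i))).trans (hOU i).le⟩, eq_univ_of_forall fun x => ?_,
    fun x => ?_⟩
  · obtain ⟨o, ho⟩ := mem_iUnion.1 (hVcov ⟨e x, rfl⟩)
    cases o with
    | none => exact absurd (mem_range_self x) (hVO none ho)
    | some i => exact mem_iUnion.2 ⟨i, ho⟩
  · refine le_trans ?_ (hord (e x))
    rw [← (Option.some_injective ι).encard_image]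
    exact encard_le_encard (image_subset_iff.2 fun i hi => hi)

/-- An open cover of a closed subspace has a refinement by open sets of the ambient space whose
order is controlled on a whole neighbourhood of the subspace. -/
theorem CoveringDimLT.exists_isOpen_cover [NormalSpace Z] {F : Set Z} (hF : IsClosed F) {k : ℕ}
    (h : CoveringDimLT F k) {ι : Type*} [Finite ι] {U : ι → Set Z} (hU : ∀ i, IsOpen (U i))
    (hcov : F ⊆ ⋃ i, U i) :
    ∃ (G : ι → Set Z) (O : Set Z), (∀ i, IsOpen (G i)) ∧ (∀ i, G i ⊆ U i) ∧ IsOpen O ∧ F ⊆ O ∧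
      O ⊆ ⋃ i, G i ∧ ∀ z ∈ O, {i | z ∈ G i}.encard ≤ k := by
  obtain ⟨V, hVo, hVU, hVcov, hord⟩ := h.exists_shrink IsInducing.subtypeVal hU
    (by rwa [Subtype.range_coe])
  rw [Subtype.range_coe] at hVcov
  obtain ⟨G, hGcov, hGo, hGV⟩ := exists_subset_iUnion_closure_subset hF hVo
    (fun _ _ => toFinite _) hVcov
  -- `H` collects the points at which the closures of too many members of `G` meet.
  let H : Set Z := ⋃ S : {S : Set ι // k < S.encard}, ⋂ i ∈ S.1, closure (G i)
  have hH : IsClosed H := isClosed_iUnion_of_finite fun S =>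
    isClosed_biInter fun i _ => isClosed_closure
  refine ⟨G, Hᶜ ∩ ⋃ i, G i, hGo, fun i => subset_closure.trans ((hGV i).trans (hVU i)),
    hH.isOpen_compl.inter (isOpen_iUnion hGo), fun z hz => ⟨fun hzH => ?_, hGcov hz⟩,
    inter_subset_right, fun z hz => ?_⟩
  · obtain ⟨⟨S, hS⟩, hzS⟩ := mem_iUnion.1 hzH
    refine (hS.trans_le (encard_le_encard fun i hi => ?_)).not_ge (hord ⟨z, hz⟩)
    exact hGV i (mem_iInter₂.1 hzS i hi)
  · by_contra! hlt
    exact hz.1 (mem_iUnion.2 ⟨⟨_, hlt⟩, mem_iInter₂.2 fun i hi => subset_closure hi⟩)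

theorem exists_pairwiseDisjoint_closure_nhds [T2Space X] [RegularSpace X] {M : Set X}
    (hM : M.Finite) {K : X → Set X} (hK : ∀ x, IsOpen (K x)) (hxK : ∀ x ∈ M, x ∈ K x) :
    ∃ T B : X → Set X, (∀ x, IsOpen (T x)) ∧ M.PairwiseDisjoint T ∧
      ∀ x ∈ M, IsOpen (B x) ∧ x ∈ B x ∧ closure (B x) ⊆ T x ∩ K x := by
  obtain ⟨T, hT, hTd⟩ := hM.t2_separation
  have hB : ∀ x, ∃ B, x ∈ M → IsOpen B ∧ x ∈ B ∧ closure B ⊆ T x ∩ K x := by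
    intro x
    by_cases hx : x ∈ M
    · obtain ⟨B, hB, hB', hBcl⟩ := exists_mem_nhds_isClosed_subset
        (((hT x).2.inter (hK x)).mem_nhds ⟨(hT x).1, hxK x hx⟩)
      exact ⟨interior B, fun _ => ⟨isOpen_interior, mem_interior_iff_mem_nhds.2 hB,
        (closure_minimal interior_subset hB').trans hBcl⟩⟩
    · exact ⟨∅, fun h => absurd h hx⟩
  choose B hB using hB
  exact ⟨T, B, fun x => (hT x).2, hTd, hB⟩

/-- The image of a ring-like fully closed map has at most the dimension of the domain: for all but
finitely many points, the fibre lies in a member of a given cover `V` of the domain, and the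
exceptional points are taken care of by neighbourhoods whose boundaries lie under one member
of `V`. -/
theorem CoveringDimLT.of_isRingLike [CompactSpace Z] [T2Space Z] [CompactSpace X] [T2Space X]
    {π : Z → X} (hπ : Continuous π) (hsurj : Function.Surjective π) (hr : IsRingLike π)
    (hfc : IsFullyClosed π) {k : ℕ} (h : CoveringDimLT Z k) : CoveringDimLT X k := by
  refine coveringDimLT_of_exists_refinement fun ι _ U hU hcov => ?_
  obtain ⟨V, hVo, hVU, hVcov, hord⟩ := h.exists_shrink (e := id) IsInducing.id
    (U := fun i => π ⁻¹' U i) (fun i => (hU i).preimage hπ)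
    (by rw [← preimage_iUnion, hcov, preimage_univ]; exact subset_univ _)
  have hVcov' : ⋃ i, V i = univ := eq_univ_of_forall fun z => hVcov ⟨z, rfl⟩
  set M : Set X := {x | ∀ i, x ∉ kernImage π (V i)} with hMdef
  have hM : M.Finite := hfc.finite_setOf_notMem_kernImage hπ hsurj hVo hVcov'
  choose σ hσ using hsurj
  choose c hc using fun x => mem_iUnion.1 (hVcov'.ge (mem_univ (σ x)))
  have hxU : ∀ x, x ∈ U (c x) := fun x => by simpa [hσ] using hVU _ (hc x)
  obtain ⟨T, B, hT, hTd, hB⟩ := exists_pairwiseDisjoint_closure_nhds hM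
    (K := fun x => U (c x)) (fun x => hU _) (fun x _ => hxU x)
  have hO : ∀ x, ∃ O, x ∈ M → IsOpen O ∧ x ∈ O ∧ O ⊆ B x ∧ π ⁻¹' frontier O ⊆ V (c x) := by
    intro x
    by_cases hx : x ∈ M
    · obtain ⟨O, h1, h2, h3, h4⟩ := hr (σ x) (V (c x)) (B x) (hVo _) (hc x) (hB x hx).1
        ((hσ x).symm ▸ (hB x hx).2.1)
      exact ⟨O, fun _ => ⟨h1, hσ x ▸ h2, h3, h4⟩⟩
    · exact ⟨∅, fun h => absurd h hx⟩
  choose O hO using hO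
  have hclT : ∀ x ∈ M, closure (O x) ⊆ T x := fun x hx =>
    (closure_mono (hO x hx).2.2.1).trans ((hB x hx).2.2.trans inter_subset_left)
  have huniq : ∀ x ∈ M, ∀ x' ∈ M, ∀ y ∈ closure (O x), y ∈ closure (O x') → x = x' :=
    fun x hx x' hx' y hy hy' => by
      by_contra hne
      exact disjoint_left.1 (hTd hx hx' hne) (hclT x hx hy) (hclT x' hx' hy')
  let W : ι → Set X := fun j => (kernImage π (V j) \ ⋃ x ∈ {x ∈ M | c x ≠ j}, closure (O x)) ∪
    ⋃ x ∈ {x ∈ M | c x = j}, O x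
  refine ⟨ι, inferInstance, W, fun j => ?_, fun j => ⟨j, ?_⟩, eq_univ_of_forall fun y => ?_,
    fun y => ?_⟩
  · exact ((isOpen_kernImage hπ (hVo j)).sdiff
      ((hM.subset (sep_subset _ _)).isClosed_biUnion fun x _ => isClosed_closure)).union
      (isOpen_biUnion fun x hx => (hO x hx.1).1)
  · rintro y (⟨hy, -⟩ | hy)
    · simpa [hσ] using hVU j (hy (hσ y))
    · obtain ⟨x, ⟨hx, rfl⟩, hyx⟩ := mem_iUnion₂.1 hy
      exact ((hB x hx).2.2 (subset_closure ((hO x hx).2.2.1 hyx))).2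
  · by_cases hy : ∃ x ∈ M, y ∈ closure (O x)
    · obtain ⟨x, hx, hyx⟩ := hy
      refine mem_iUnion.2 ⟨c x, ?_⟩
      by_cases hyO : y ∈ O x
      · exact Or.inr (mem_iUnion₂.2 ⟨x, ⟨hx, rfl⟩, hyO⟩)
      · refine Or.inl ⟨fun z hz => (hO x hx).2.2.2 ?_, fun hmem => ?_⟩
        · rw [mem_preimage, hz, (hO x hx).1.frontier_eq]
          exact ⟨hyx, hyO⟩
        · obtain ⟨x', ⟨hx', hne⟩, hyx'⟩ := mem_iUnion₂.1 hmem
          exact hne (by rw [huniq x hx x' hx' y hyx hyx'])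
    · push Not at hy
      have hyM : y ∉ M := fun h => hy y h (subset_closure (hO y h).2.1)
      simp only [hMdef, mem_ofPred_eq, not_forall, not_not] at hyM
      obtain ⟨j, hj⟩ := hyM
      refine mem_iUnion.2 ⟨j, Or.inl ⟨hj, fun hmem => ?_⟩⟩
      obtain ⟨x', ⟨hx', -⟩, hyx'⟩ := mem_iUnion₂.1 hmem
      exact hy x' hx' hyx'
  · by_cases hy : ∃ x ∈ M, y ∈ O x
    · obtain ⟨x, hx, hyx⟩ := hy
      have hsub : {j | y ∈ W j} ⊆ {c x} := by
        rintro j (⟨-, hj⟩ | hj)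
        · by_contra hne
          exact hj (mem_iUnion₂.2 ⟨x, ⟨hx, Ne.symm hne⟩, subset_closure hyx⟩)
        · obtain ⟨x', ⟨hx', rfl⟩, hyx'⟩ := mem_iUnion₂.1 hj
          rw [huniq x hx x' hx' y (subset_closure hyx) (subset_closure hyx')]
          rfl
      -- The order bound `k` of a cover of the nonempty space `Z` is at least one.
      refine (encard_le_encard hsub).trans (le_trans ?_ (hord (σ x)))
      rw [encard_singleton, one_le_encard_iff_nonempty]
      exact ⟨c x, hc x⟩
    · refine le_trans (encard_le_encard ?_) (hord (σ y))
      rintro j (⟨hj, -⟩ | hj)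
      · exact hj (hσ y)
      · obtain ⟨x', ⟨hx', -⟩, hyx'⟩ := mem_iUnion₂.1 hj
        exact absurd ⟨x', hx', hyx'⟩ hy

/-- A ring-like fully closed map does not raise the dimension above the dimensions of the target
and of the fibres. Only finitely many fibres are not contained in a member of a given cover; near
such a fibre, a refinement `G` of small order is used over a neighbourhood whose boundary lies
under a single member of `G`, and a refinement coming from the target is used elsewhere. -/
theorem coveringDimLT_of_fibres [CompactSpace Z] [T2Space Z] [CompactSpace X] [T2Space X]
    {π : Z → X} (hπ : Continuous π) (hsurj : Function.Surjective π) (hr : IsRingLike π)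
    (hfc : IsFullyClosed π) {k : ℕ} (hX : CoveringDimLT X k)
    (hfib : ∀ x, CoveringDimLT (π ⁻¹' {x} : Set Z) k) : CoveringDimLT Z k := by
  classical
  refine coveringDimLT_of_exists_refinement fun ι _ U hU hcov => ?_
  set M : Set X := {x | ∀ i, x ∉ kernImage π (U i)} with hMdef
  have hM : M.Finite := hfc.finite_setOf_notMem_kernImage hπ hsurj hU hcov
  have : Finite M := hM
  choose G R hGo hGU hRo hFR hRG hord using fun x => (hfib x).exists_isOpen_cover
    (isClosed_singleton.preimage hπ) hU (hcov.ge.trans' (subset_univ _))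
  choose σ hσ using hsurj
  choose c hc using fun x => mem_iUnion.1 (hRG x (hFR x (hσ x)))
  obtain ⟨T, B, hT, hTd, hB⟩ := exists_pairwiseDisjoint_closure_nhds hM
    (K := fun x => kernImage π (R x)) (fun x => isOpen_kernImage hπ (hRo x))
    (fun x _ z hz => hFR x hz)
  have hO : ∀ x, ∃ O, x ∈ M → IsOpen O ∧ x ∈ O ∧ O ⊆ B x ∧ π ⁻¹' frontier O ⊆ G x (c x) := by
    intro x
    by_cases hx : x ∈ M
    · obtain ⟨O, h1, h2, h3, h4⟩ := hr (σ x) (G x (c x)) (B x) (hGo _ _) (hc x) (hB x hx).1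
        ((hσ x).symm ▸ (hB x hx).2.1)
      exact ⟨O, fun _ => ⟨h1, hσ x ▸ h2, h3, h4⟩⟩
    · exact ⟨∅, fun h => absurd h hx⟩
  choose O hO using hO
  have hclT : ∀ x ∈ M, closure (O x) ⊆ T x := fun x hx =>
    (closure_mono (hO x hx).2.2.1).trans ((hB x hx).2.2.trans inter_subset_left)
  have hOR : ∀ x ∈ M, ∀ z, π z ∈ O x → z ∈ R x := fun x hx z hz =>
    ((hB x hx).2.2 (subset_closure ((hO x hx).2.2.1 hz))).2 rfl
  -- The cover of `X` to which the dimension of `X` is applied.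
  let N : M ⊕ ι → Set X := Sum.elim (fun x => O x ∪ (T x ∩ kernImage π (G x (c x))))
    (fun i => kernImage π (U i) \ ⋃ x ∈ M, closure (O x))
  have hN : ∀ a, IsOpen (N a) := Sum.forall.2
    ⟨fun x => (hO x x.2).1.union ((hT x).inter (isOpen_kernImage hπ (hGo _ _))),
      fun i => (isOpen_kernImage hπ (hU i)).sdiff
        (hM.isClosed_biUnion fun x _ => isClosed_closure)⟩
  have hNT : ∀ x : M, N (Sum.inl x) ⊆ T x := fun x =>
    union_subset (subset_closure.trans (hclT x x.2)) inter_subset_left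
  have hNcov : ⋃ a, N a = univ := by
    refine eq_univ_of_forall fun y => ?_
    by_cases hy : ∃ x ∈ M, y ∈ closure (O x)
    · obtain ⟨x, hx, hyx⟩ := hy
      refine mem_iUnion.2 ⟨Sum.inl ⟨x, hx⟩, ?_⟩
      by_cases hyO : y ∈ O x
      · exact Or.inl hyO
      · refine Or.inr ⟨hclT x hx hyx, fun z hz => (hO x hx).2.2.2 ?_⟩
        rw [mem_preimage, hz, (hO x hx).1.frontier_eq]
        exact ⟨hyx, hyO⟩
    · have hyM : y ∉ M := fun h => hy ⟨y, h, subset_closure (hO y h).2.1⟩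
      simp only [hMdef, mem_ofPred_eq, not_forall, not_not] at hyM
      obtain ⟨i, hi⟩ := hyM
      exact mem_iUnion.2 ⟨Sum.inr i, hi, fun hmem => hy (by simpa using hmem)⟩
  obtain ⟨V, hVo, hVN, hVcov, hVord⟩ := hX.exists_shrink (e := id) IsInducing.id hN
    (hNcov.ge.trans' (subset_univ _))
  have hVcov' : ∀ y, ∃ a, y ∈ V a := fun y => mem_iUnion.1 (hVcov ⟨y, rfl⟩)
  have honly : ∀ x : M, ∀ y ∈ O x, ∀ a, y ∈ V a → a = Sum.inl x := by
    rintro x y hy (x' | i) ha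
    · by_contra hne
      exact disjoint_left.1 (hTd x'.2 x.2 fun h => hne (by rw [Subtype.ext h]))
        (hNT x' (hVN _ ha)) (hclT x x.2 (subset_closure hy))
    · exact absurd (mem_biUnion x.2 (subset_closure hy)) (hVN _ ha).2
  let S : (M × ι) ⊕ ι → Set Z := Sum.elim
    (fun p => π ⁻¹' (if p.2 = c p.1 then V (Sum.inl p.1) else O p.1) ∩ G p.1 p.2)
    (fun i => π ⁻¹' V (Sum.inr i))
  refine ⟨(M × ι) ⊕ ι, inferInstance, S, Sum.forall.2 ⟨fun p => ?_, fun i =>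
    (hVo _).preimage hπ⟩, Sum.forall.2 ⟨fun p => ⟨p.2, inter_subset_right.trans (hGU _ _)⟩,
      fun i => ⟨i, fun z hz => (hVN _ hz).1 rfl⟩⟩, eq_univ_of_forall fun z => ?_, fun z => ?_⟩
  · refine IsOpen.inter (IsOpen.preimage hπ ?_) (hGo _ _)
    split_ifs
    exacts [hVo _, (hO _ p.1.2).1]
  · obtain ⟨a, ha⟩ := hVcov' (π z)
    by_cases hz : ∃ x : M, π z ∈ O x
    · obtain ⟨x, hx⟩ := hz
      obtain rfl := honly x _ hx a ha
      obtain ⟨j, hj⟩ := mem_iUnion.1 (hRG x (hOR x x.2 z hx))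
      refine mem_iUnion.2 ⟨Sum.inl (x, j), ?_, hj⟩
      rw [mem_preimage]
      split_ifs
      exacts [ha, hx]
    · rcases a with x | i
      · refine mem_iUnion.2 ⟨Sum.inl (x, c x), ?_, ?_⟩
        · simpa using ha
        · exact ((hVN _ ha).resolve_left fun h => hz ⟨x, h⟩).2 rfl
      · exact mem_iUnion.2 ⟨Sum.inr i, ha⟩
  · by_cases hz : ∃ x : M, π z ∈ O x
    · obtain ⟨x, hx⟩ := hz
      refine le_trans (encard_le_encard (t := (fun j => Sum.inl (x, j)) '' {j | z ∈ G x j}) ?_)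
        ((encard_image_le _ _).trans (hord x z (hOR x x.2 z hx)))
      rintro (⟨x', j⟩ | i) ha
      · obtain ⟨h1, h2⟩ := ha
        obtain rfl : x' = x := by
          rw [mem_preimage] at h1
          split_ifs at h1
          · exact Sum.inl_injective (honly x _ hx _ h1)
          · by_contra hne
            exact disjoint_left.1 (hTd x'.2 x.2 fun h => hne (Subtype.ext h))
              (hclT x' x'.2 (subset_closure h1)) (hclT x x.2 (subset_closure hx))
        exact ⟨j, h2, rfl⟩
      · exact absurd (honly x _ hx _ ha) Sum.inr_ne_inl
    · refine le_trans (encard_le_encard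
        (t := Sum.elim (fun x : M => Sum.inl (x, c x)) Sum.inr '' {a | π z ∈ V a}) ?_)
        ((encard_image_le _ _).trans (hVord (π z)))
      rintro (⟨x, j⟩ | i) ha
      · obtain ⟨h1, -⟩ := ha
        rw [mem_preimage] at h1
        split_ifs at h1 with hj
        · exact ⟨Sum.inl x, h1, by rw [Sum.elim_inl]; exact congrArg Sum.inl (Prod.ext rfl hj.symm)⟩
        · exact absurd ⟨x, h1⟩ hz
      · exact ⟨Sum.inr i, ha, rfl⟩

theorem coveringDim_le_iff {n : WithBot ℕ∞} :
    coveringDim X ≤ n ↔ ∀ k : ℕ, n < k → CoveringDimLT X k := by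
  have hmem : coveringDim X ∈ {n : WithBot ℕ∞ | ∀ k : ℕ, n < k → CoveringDimLT X k} :=
    csInf_mem ⟨⊤, fun k hk => absurd hk not_top_lt⟩
  exact ⟨fun h k hk => hmem k (h.trans_lt hk), fun h => sInf_le h⟩

theorem coveringDim_eq_max [CompactSpace Z] [T2Space Z] [CompactSpace X] [T2Space X]
    {π : Z → X} (hπ : Continuous π) (hsurj : Function.Surjective π) (hr : IsRingLike π)
    (hfc : IsFullyClosed π) : coveringDim Z = max (coveringDim X) (mapCoveringDim π) := by
  refine le_antisymm (coveringDim_le_iff.2 fun k hk => ?_) (max_le ?_ (iSup_le fun x => ?_))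
  · rw [max_lt_iff] at hk
    exact coveringDimLT_of_fibres hπ hsurj hr hfc (coveringDim_le_iff.1 le_rfl k hk.1) fun x =>
      coveringDim_le_iff.1 le_rfl k ((le_iSup (fun y => coveringDim (π ⁻¹' {y})) x).trans_lt hk.2)
  · exact coveringDim_le_iff.2 fun k hk =>
      (coveringDim_le_iff.1 le_rfl k hk).of_isRingLike hπ hsurj hr hfc
  · exact coveringDim_le_iff.2 fun k hk => (coveringDim_le_iff.1 le_rfl k hk).of_isClosedEmbedding
      (isClosed_singleton.preimage hπ).isClosedEmbedding_subtypeVal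

end CoveringDimension

end RingLikeResolution

/-! ### Large inductive dimension of subsets of perfectly normal spaces -/

namespace RingLikeResolution

section RelativeInd

variable {X : Type u} {Z : Type w} [TopologicalSpace X] [TopologicalSpace Z]

/-- The subspace `s` has large inductive dimension `< k`. The closed sets `P`, `Q` stand for the
two sides of a partition together with the partition, which is `s ∩ P ∩ Q`. In this form, all
closed sets are taken in the ambient space, so that no subspaces of subspaces occur. -/
def IndLT : ℕ → Set X → Prop
  | 0, s => s = ∅
  | k + 1, s => ∀ A B : Set X, IsClosed A → IsClosed B → s ∩ A ∩ B = ∅ →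
      ∃ P Q : Set X, IsClosed P ∧ IsClosed Q ∧ s ⊆ P ∪ Q ∧ s ∩ A ∩ Q = ∅ ∧ s ∩ B ∩ P = ∅ ∧
        IndLT k (s ∩ P ∩ Q)

theorem IndLT.inter_isClosed {k : ℕ} {s C : Set X} (h : IndLT k s) (hC : IsClosed C) :
    IndLT k (s ∩ C) := by
  induction k generalizing s with
  | zero =>
    obtain rfl : s = ∅ := h
    exact empty_inter C
  | succ k ih =>
    intro A B hA hB hAB
    obtain ⟨P, Q, hP, hQ, hPQ, hAQ, hBP, hL⟩ := h (C ∩ A) B (hC.inter hA) hB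
      (by rwa [← inter_assoc])
    refine ⟨P, Q, hP, hQ, inter_subset_left.trans hPQ, by rwa [inter_assoc s],
      subset_empty_iff.1 (hBP ▸ fun z hz => ⟨⟨hz.1.1.1, hz.1.2⟩, hz.2⟩), ?_⟩
    rw [inter_right_comm s C P, inter_right_comm _ C Q]
    exact ih hL

theorem IndLT.of_eq_inter {k : ℕ} {s t C : Set X} (h : IndLT k s) (hC : IsClosed C)
    (ht : t = s ∩ C) : IndLT k t :=
  ht ▸ h.inter_isClosed hC

theorem indLT_empty (k : ℕ) : IndLT k (∅ : Set X) := by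
  induction k with
  | zero => rfl
  | succ k ih => exact fun A B hA hB _ => ⟨∅, ∅, isClosed_empty, isClosed_empty, by simpa⟩

theorem IndLT.succ {k : ℕ} {s : Set X} (h : IndLT k s) : IndLT (k + 1) s := by
  induction k generalizing s with
  | zero =>
    obtain rfl : s = ∅ := h
    exact indLT_empty 1
  | succ k ih =>
    intro A B hA hB hAB
    obtain ⟨P, Q, hP, hQ, hPQ, hAQ, hBP, hL⟩ := h A B hA hB hAB
    exact ⟨P, Q, hP, hQ, hPQ, hAQ, hBP, ih hL⟩

theorem IndLT.mono {k l : ℕ} (hkl : k ≤ l) {s : Set X} (h : IndLT k s) : IndLT l s := by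
  induction hkl with
  | refl => exact h
  | step _ ih => exact ih.succ

theorem indLT_one_of_finite [T1Space X] {s : Set X} (hs : s.Finite) : IndLT 1 s := by
  intro A B hA hB hAB
  refine ⟨s \ B, s ∩ B, hs.sdiff.isClosed, (hs.inter_of_left B).isClosed,
    (sdiff_union_inter s B).ge, ?_, ?_, ?_⟩
  · rw [inter_inter_inter_comm, inter_self, ← inter_assoc, hAB]
  · exact subset_empty_iff.1 fun z hz => hz.2.2 hz.1.2
  · exact subset_empty_iff.1 fun z hz => hz.1.2.2 hz.2.2

theorem indLT_image_iff {e : X → Z} (he : IsInducing e) {k : ℕ} {s : Set X} :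
    IndLT k (e '' s) ↔ IndLT k s := by
  induction k generalizing s with
  | zero => exact image_eq_empty
  | succ k ih =>
    have himg : ∀ A B : Set Z, e '' (s ∩ e ⁻¹' A ∩ e ⁻¹' B) = e '' s ∩ A ∩ B := fun A B => by
      rw [image_inter_preimage, image_inter_preimage]
    have hemp : ∀ A B : Set Z, s ∩ e ⁻¹' A ∩ e ⁻¹' B = ∅ ↔ e '' s ∩ A ∩ B = ∅ := fun A B => by
      rw [← himg, image_eq_empty]
    constructor
    · intro h A B hA hB hAB
      obtain ⟨A, hA', rfl⟩ := he.isClosed_iff.1 hA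
      obtain ⟨B, hB', rfl⟩ := he.isClosed_iff.1 hB
      obtain ⟨P, Q, hP, hQ, hPQ, hAQ, hBP, hL⟩ := h A B hA' hB' ((hemp A B).1 hAB)
      refine ⟨e ⁻¹' P, e ⁻¹' Q, hP.preimage he.continuous, hQ.preimage he.continuous,
        (image_subset_iff (f := e)).1 hPQ, (hemp A Q).2 hAQ, (hemp B P).2 hBP, ih.1 ?_⟩
      rwa [himg]
    · intro h A B hA hB hAB
      obtain ⟨P, Q, hP, hQ, hPQ, hAQ, hBP, hL⟩ := h (e ⁻¹' A) (e ⁻¹' B)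
        (hA.preimage he.continuous) (hB.preimage he.continuous) ((hemp A B).2 hAB)
      obtain ⟨P, hP', rfl⟩ := he.isClosed_iff.1 hP
      obtain ⟨Q, hQ', rfl⟩ := he.isClosed_iff.1 hQ
      refine ⟨P, Q, hP', hQ', image_subset_iff.2 hPQ, (hemp A Q).1 hAQ, (hemp B P).1 hBP, ?_⟩
      rw [← himg]
      exact ih.2 hL

theorem indLT_univ_coe_iff {k : ℕ} {s : Set X} : IndLT k (univ : Set s) ↔ IndLT k s := by
  rw [← indLT_image_iff IsInducing.subtypeVal, image_univ, Subtype.range_coe]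

theorem largeIndLT_iff_indLT_univ {k : ℕ} {X : Type u} [TopologicalSpace X] :
    LargeIndLT k X ↔ IndLT k (univ : Set X) := by
  induction k generalizing X with
  | zero => exact univ_eq_empty_iff.symm
  | succ k ih =>
    constructor
    · intro h A B hA hB hAB
      rw [univ_inter] at hAB
      obtain ⟨L, ⟨U, V, hU, hV, hUV, hL, hAU, hBV⟩, hLk⟩ :=
        h A B hA hB (disjoint_iff_inter_eq_empty.2 hAB)
      refine ⟨Vᶜ, Uᶜ, hV.isClosed_compl, hU.isClosed_compl, ?_, ?_, ?_, ?_⟩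
      · rw [← compl_inter, inter_comm, hUV.inter_eq, compl_empty]
      · rw [univ_inter, ← disjoint_iff_inter_eq_empty, disjoint_compl_right_iff_subset]
        exact hAU
      · rw [univ_inter, ← disjoint_iff_inter_eq_empty, disjoint_compl_right_iff_subset]
        exact hBV
      · rw [univ_inter, inter_comm, ← compl_union, ← hL, compl_compl, ← indLT_univ_coe_iff]
        exact ih.1 hLk
    · intro h A B hA hB hAB
      obtain ⟨P, Q, hP, hQ, hPQ, hAQ, hBP, hL⟩ := h A B hA hB
        (by rw [univ_inter, hAB.inter_eq])
      rw [univ_inter, ← disjoint_iff_inter_eq_empty, ← subset_compl_iff_disjoint_right] at hAQ hBP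
      rw [univ_inter] at hL
      refine ⟨P ∩ Q, ⟨Qᶜ, Pᶜ, hQ.isOpen_compl, hP.isOpen_compl, ?_, ?_, hAQ, hBP⟩, ?_⟩
      · rw [disjoint_compl_left_iff_subset, compl_subset_iff_union, union_comm P]
        exact univ_subset_iff.1 (union_comm P Q ▸ hPQ)
      · rw [compl_inter, union_comm]
      · rw [ih, indLT_univ_coe_iff]
        exact hL

end RelativeInd

section PerfectlyNormal

variable {X : Type u} [TopologicalSpace X] [PerfectlyNormalSpace X]

/-- If `A` and `B` are the zero sets of `a` and `b`, then the sets `{2 a < b}` and `{2 b < a}` have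
the required properties. -/
theorem exists_isOpen_closure_inter_closure_subset {A B : Set X} (hA : IsClosed A)
    (hB : IsClosed B) : ∃ U V : Set X, IsOpen U ∧ IsOpen V ∧ Disjoint U V ∧ A \ B ⊆ U ∧
      B \ A ⊆ V ∧ closure U ∩ closure V ⊆ A ∩ B := by
  obtain ⟨a, rfl, ha⟩ := perfectlyNormalSpace_iff_forall_isClosed_preimage_zero.1 ‹_› A hA
  obtain ⟨b, rfl, hb⟩ := perfectlyNormalSpace_iff_forall_isClosed_preimage_zero.1 ‹_› B hB
  have hcl : ∀ f g : C(X, ℝ), closure {x | 2 * f x < g x} ⊆ {x | 2 * f x ≤ g x} := fun f g =>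
    closure_minimal (fun x hx => show 2 * f x ≤ g x from le_of_lt hx)
      (isClosed_le (by fun_prop) (by fun_prop))
  have hsub : ∀ f g : C(X, ℝ), (∀ x, g x ∈ Icc (0 : ℝ) 1) →
      f ⁻¹' {0} \ g ⁻¹' {0} ⊆ {x | 2 * f x < g x} := by
    rintro f g hg x ⟨hx, hx'⟩
    have h0 : f x = 0 := hx
    have h1 : 0 < g x := (hg x).1.lt_of_ne' hx'
    show 2 * f x < g x
    linarith
  refine ⟨{x | 2 * a x < b x}, {x | 2 * b x < a x}, isOpen_lt (by fun_prop) (by fun_prop),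
    isOpen_lt (by fun_prop) (by fun_prop), disjoint_left.2 fun x h1 h2 => ?_, hsub a b hb,
    hsub b a ha, fun x hx => ?_⟩
  · have h1 : 2 * a x < b x := h1
    have h2 : 2 * b x < a x := h2
    linarith [(ha x).1, (hb x).1]
  · have h1 : 2 * a x ≤ b x := hcl a b hx.1
    have h2 : 2 * b x ≤ a x := hcl b a hx.2
    constructor
    · show a x = 0
      linarith [(ha x).1, (hb x).1]
    · show b x = 0
      linarith [(ha x).1, (hb x).1]

/-- The sum theorem in dimension `< k` implies that open subspaces have at most the dimension of
the space in dimension `< k + 1`: the open set is cut into countably many layers, and the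
partitions obtained for the layers are put together to a locally finite union. -/
theorem IndLT.inter_isOpen_of_sum {k : ℕ}
    (hsum : ∀ (s : Set X) (C : ℕ → Set X), (∀ i, IsClosed (C i)) → s ⊆ ⋃ i, C i →
      (∀ i, IndLT k (s ∩ C i)) → IndLT k s)
    {s O : Set X} (h : IndLT (k + 1) s) (hO : IsOpen O) : IndLT (k + 1) (s ∩ O) := by
  intro A B hA hB hAB
  obtain ⟨f, hf, hf01⟩ := perfectlyNormalSpace_iff_forall_isClosed_preimage_zero.1 ‹_› Oᶜ
    hO.isClosed_compl
  have hfO : ∀ {x}, x ∈ O ↔ 0 < f x := fun {x} => by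
    rw [← not_iff_not, ← mem_compl_iff, hf, mem_preimage, mem_singleton_iff, not_lt,
      le_antisymm_iff, and_iff_left (hf01 x).1]
  -- The layers are given by `r (i + 1) ≤ f ≤ r i`, and the `i`-th partition is confined to
  -- `r (i + 2) ≤ f ≤ 2 * r i`.
  let r : ℕ → ℝ := fun i => (1 / 2) ^ i
  have hr : ∀ i, 0 < r i := fun i => by positivity
  have hr1 : ∀ i, 2 * r (i + 1) = r i := fun i => by simp only [r, pow_succ]; ring
  have hrlt : ∀ {i j}, i < j → 2 * r j ≤ r i := fun {i j} hij => by
    obtain ⟨d, rfl⟩ := Nat.exists_eq_add_of_lt hij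
    rw [hr1]
    exact pow_le_pow_of_le_one (by norm_num) (by norm_num) (by omega)
  have hAB' : ∀ i, s ∩ (A ∩ (f ⁻¹' Icc (r (i + 1)) (r i))) ∩
      (B ∪ f ⁻¹' Iic (r (i + 2)) ∪ f ⁻¹' Ici (2 * r i)) = ∅ := by
    refine fun i => subset_empty_iff.1 ?_
    rintro x ⟨⟨hxs, hxA, h1, h2⟩, (hxB | h3) | h3⟩
    · exact hAB.le ⟨⟨⟨hxs, hfO.2 ((hr _).trans_le h1)⟩, hxA⟩, hxB⟩
    · have h3 : f x ≤ r (i + 2) := h3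
      linarith [hr1 (i + 1), hr (i + 2)]
    · have h3 : 2 * r i ≤ f x := h3
      linarith [hr i]
  have hfc := f.continuous
  choose P Q hP hQ hPQ hAQ hBP hL using fun i => h _ _
    (hA.inter (isClosed_Icc.preimage hfc))
    ((hB.union (isClosed_Iic.preimage hfc)).union (isClosed_Ici.preimage hfc)) (hAB' i)
  let R : ℕ → Set X := fun i => P i ∩ f ⁻¹' Icc (r (i + 2)) (2 * r i)
  have hR : ∀ i, IsClosed (R i) := fun i => (hP i).inter (isClosed_Icc.preimage hfc)
  -- `S` is the union of the sets `R i` and the complement of `O`.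
  let S : Set X := ⋂ N, (f ⁻¹' Iic (r N) ∪ ⋃ i ∈ Iic N, R i)
  have hS : IsClosed S := isClosed_iInter fun N => (isClosed_Iic.preimage hfc).union
    ((finite_Iic N).isClosed_biUnion fun i _ => hR i)
  have hRS : ∀ i, R i ⊆ S := fun i x hx => mem_iInter.2 fun N => by
    rcases le_or_gt i N with hi | hi
    · exact Or.inr (mem_biUnion hi hx)
    · exact Or.inl (hx.2.2.trans (hrlt hi))
  have hSR : ∀ x ∈ O, x ∈ S → ∃ i, x ∈ R i := fun x hxO hxS => by
    obtain ⟨N, hN⟩ := exists_pow_lt_of_lt_one (hfO.1 hxO) (by norm_num : (1 / 2 : ℝ) < 1)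
    rcases mem_iInter.1 hxS N with hx | hx
    · exact absurd hN (not_lt.2 hx)
    · obtain ⟨i, -, hi⟩ := mem_iUnion₂.1 hx
      exact ⟨i, hi⟩
  refine ⟨S, ⋂ i, Q i, hS, isClosed_iInter hQ, ?_, ?_, ?_, ?_⟩
  · rintro x ⟨hxs, hxO⟩
    by_contra hx
    simp only [mem_union, mem_iInter, not_or, not_forall] at hx
    obtain ⟨hxS, i, hi⟩ := hx
    have hxP := (hPQ i hxs).resolve_right hi
    have hxB : x ∉ B ∪ f ⁻¹' Iic (r (i + 2)) ∪ f ⁻¹' Ici (2 * r i) := fun hxB =>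
      (hBP i).le ⟨⟨hxs, hxB⟩, hxP⟩
    simp only [mem_union, mem_preimage, mem_Iic, mem_Ici, not_or, not_le] at hxB
    exact hxS (hRS i ⟨hxP, hxB.1.2.le, hxB.2.le⟩)
  · refine subset_empty_iff.1 ?_
    rintro x ⟨⟨⟨hxs, hxO⟩, hxA⟩, hxQ⟩
    obtain ⟨i, h1, h2⟩ := exists_nat_pow_near_of_lt_one (hfO.1 hxO) (hf01 x).2
      (by norm_num : (0 : ℝ) < 1 / 2) (by norm_num)
    exact (hAQ i).le ⟨⟨hxs, hxA, h1.le, h2⟩, mem_iInter.1 hxQ i⟩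
  · refine subset_empty_iff.1 ?_
    rintro x ⟨⟨⟨hxs, hxO⟩, hxB⟩, hxS⟩
    obtain ⟨i, hi⟩ := hSR x hxO hxS
    exact (hBP i).le ⟨⟨hxs, Or.inl (Or.inl hxB)⟩, hi.1⟩
  · refine hsum _ R hR (fun x hx => mem_iUnion.2 (hSR x hx.1.1.2 hx.1.2)) fun i => ?_
    refine (hL i).of_eq_inter ((hR i).inter (isClosed_iInter hQ)) ?_
    ext x
    constructor
    · rintro ⟨⟨⟨⟨hxs, hxO⟩, hxS⟩, hxQ⟩, hxR⟩
      exact ⟨⟨⟨hxs, hxR.1⟩, mem_iInter.1 hxQ i⟩, hxR, hxQ⟩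
    · rintro ⟨⟨⟨hxs, -⟩, -⟩, hxR, hxQ⟩
      exact ⟨⟨⟨⟨hxs, hfO.2 ((hr _).trans_le hxR.2.1)⟩, hRS i hxR⟩, hxQ⟩, hxR⟩

/-- One step in the proof of the sum theorem: a pair of disjoint open sets `U`, `V` is enlarged so
that it also covers `C`, up to a set `D` whose dimension is controlled outside the set
`closure U ∩ closure V` of points spoiled earlier. -/
theorem IndLT.exists_isOpen_extension {k : ℕ} {s C : Set X} (hC : IsClosed C)
    (h : ∀ O : Set X, IsOpen O → IndLT (k + 1) (s ∩ C ∩ O)) {U V : Set X} (hU : IsOpen U)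
    (hV : IsOpen V) (hUV : Disjoint U V) :
    ∃ U' V' D : Set X, IsOpen U' ∧ IsOpen V' ∧ Disjoint U' V' ∧ IsClosed D ∧ s ∩ U ⊆ U' ∧
      s ∩ V ⊆ V' ∧ s ∩ C ⊆ (U' ∪ V') ∪ (closure U ∩ closure V ∪ D) ∧
      s ∩ (closure U' ∩ closure V') ⊆ closure U ∩ closure V ∪ D ∧
      IndLT k (s ∩ D ∩ (closure U ∩ closure V)ᶜ) := by
  set K := closure U ∩ closure V with hK
  have hKc : IsClosed K := isClosed_closure.inter isClosed_closure
  obtain ⟨P, Q, hP, hQ, hPQ, hUQ, hVP, hL⟩ := h Kᶜ hKc.isOpen_compl (closure U) (closure V)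
    isClosed_closure isClosed_closure
    (subset_empty_iff.1 fun x hx => hx.1.1.2 ⟨hx.1.2, hx.2⟩)
  obtain ⟨U', V', hU', hV', hUV', hAU, hBV, hcl⟩ := exists_isOpen_closure_inter_closure_subset
    (isClosed_closure.union (hC.inter hP) : IsClosed (closure U ∪ C ∩ P))
    (isClosed_closure.union (hC.inter hQ) : IsClosed (closure V ∪ C ∩ Q))
  have hQ' : ∀ x ∈ s, x ∈ C → x ∈ closure U → x ∈ Q → x ∈ K := fun x hs hx hxU hxQ => by
    by_contra hxK
    exact hUQ.le ⟨⟨⟨⟨hs, hx⟩, hxK⟩, hxU⟩, hxQ⟩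
  have hP' : ∀ x ∈ s, x ∈ C → x ∈ closure V → x ∈ P → x ∈ K := fun x hs hx hxV hxP => by
    by_contra hxK
    exact hVP.le ⟨⟨⟨⟨hs, hx⟩, hxK⟩, hxV⟩, hxP⟩
  have hUV₁ : ∀ x ∈ U, x ∉ closure V := fun x hx hxV =>
    disjoint_left.1 (hUV.closure_right hU) hx hxV
  have hUV₂ : ∀ x ∈ V, x ∉ closure U := fun x hx hxU =>
    disjoint_left.1 (hUV.closure_left hV) hxU hx
  have hboth : ∀ x ∈ s, x ∈ closure U ∪ C ∩ P → x ∈ closure V ∪ C ∩ Q → x ∈ K ∪ C ∩ P ∩ Q := by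
    rintro x hs (h1 | h1) (h2 | h2)
    · exact Or.inl ⟨h1, h2⟩
    · exact Or.inl (hQ' x hs h2.1 h1 h2.2)
    · exact Or.inl (hP' x hs h1.1 h2 h1.2)
    · exact Or.inr ⟨h1, h2.2⟩
  refine ⟨U', V', C ∩ P ∩ Q, hU', hV', hUV', (hC.inter hP).inter hQ, ?_, ?_, ?_, ?_, ?_⟩
  · rintro x ⟨hxs, hx⟩
    refine hAU ⟨Or.inl (subset_closure hx), ?_⟩
    rintro (h1 | h1)
    · exact hUV₁ x hx h1
    · exact hUV₁ x hx (hQ' x hxs h1.1 (subset_closure hx) h1.2).2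
  · rintro x ⟨hxs, hx⟩
    refine hBV ⟨Or.inl (subset_closure hx), ?_⟩
    rintro (h1 | h1)
    · exact hUV₂ x hx h1
    · exact hUV₂ x hx (hP' x hxs h1.1 (subset_closure hx) h1.2).1
  · rintro x ⟨hxs, hxC⟩
    by_cases hxK : x ∈ K
    · exact Or.inr (Or.inl hxK)
    · by_cases hA : x ∈ closure U ∪ C ∩ P
      · by_cases hB : x ∈ closure V ∪ C ∩ Q
        · exact Or.inr (hboth x hxs hA hB)
        · exact Or.inl (Or.inl (hAU ⟨hA, hB⟩))
      · have hxQ := (hPQ ⟨⟨hxs, hxC⟩, hxK⟩).resolve_left fun hxP => hA (Or.inr ⟨hxC, hxP⟩)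
        exact Or.inl (Or.inr (hBV ⟨Or.inr ⟨hxC, hxQ⟩, hA⟩))
  · rintro x ⟨hxs, hx⟩
    exact hboth x hxs (hcl hx).1 (hcl hx).2
  · convert hL using 1
    ext x
    simp only [mem_inter_iff]
    tauto

theorem exists_isClosed_iUnion_eq {O : Set X} (hO : IsOpen O) :
    ∃ E : ℕ → Set X, (∀ i, IsClosed (E i)) ∧ ⋃ i, E i = O := by
  obtain ⟨W, hW, hWeq⟩ := isGδ_iff_eq_iInter_nat.1 hO.isClosed_compl.isGδ
  exact ⟨fun i => (W i)ᶜ, fun i => (hW i).isClosed_compl, by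
    rw [← compl_iInter, ← hWeq, compl_compl]⟩

/-- The inductive step in the proof of the sum theorem: the disjoint open sets that contain `A` and
`B` are enlarged successively, so as to cover the sets `C i` up to a set of dimension `< k`. -/
theorem IndLT.sum_succ {k : ℕ}
    (hsum : ∀ (s : Set X) (C : ℕ → Set X), (∀ i, IsClosed (C i)) → s ⊆ ⋃ i, C i →
      (∀ i, IndLT k (s ∩ C i)) → IndLT k s)
    {s : Set X} {C : ℕ → Set X} (hC : ∀ i, IsClosed (C i)) (hcov : s ⊆ ⋃ i, C i)
    (h : ∀ i, IndLT (k + 1) (s ∩ C i)) : IndLT (k + 1) s := by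
  intro A B hA hB hAB
  choose! U' V' D hU' hV' hUV' hD hUU' hVV' hcov' hcl hDk using
    fun i (p : Set X × Set X) (hU : IsOpen p.1) (hV : IsOpen p.2) (hUV : Disjoint p.1 p.2) =>
      IndLT.exists_isOpen_extension (hC i) (fun O hO => (h i).inter_isOpen_of_sum hsum hO) hU hV hUV
  obtain ⟨U₀, V₀, hU₀, hV₀, hUV₀, hAU, hBV, hcl₀⟩ :=
    exists_isOpen_closure_inter_closure_subset hA hB
  let p : ℕ → Set X × Set X := fun n =>
    Nat.rec (U₀, V₀) (fun i q => (U' i q, V' i q)) n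
  have hp : ∀ n, IsOpen (p n).1 ∧ IsOpen (p n).2 ∧ Disjoint (p n).1 (p n).2 := by
    intro n
    induction n with
    | zero => exact ⟨hU₀, hV₀, hUV₀⟩
    | succ n ih =>
      exact ⟨hU' n _ ih.1 ih.2.1 ih.2.2, hV' n _ ih.1 ih.2.1 ih.2.2, hUV' n _ ih.1 ih.2.1 ih.2.2⟩
  have hmono₁ : ∀ {m n}, m ≤ n → s ∩ (p m).1 ⊆ (p n).1 := fun {m n} hmn => by
    induction hmn with
    | refl => exact inter_subset_right
    | step _ ih => exact fun x hx => hUU' _ _ (hp _).1 (hp _).2.1 (hp _).2.2 ⟨hx.1, ih hx⟩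
  have hmono₂ : ∀ {m n}, m ≤ n → s ∩ (p m).2 ⊆ (p n).2 := fun {m n} hmn => by
    induction hmn with
    | refl => exact inter_subset_right
    | step _ ih => exact fun x hx => hVV' _ _ (hp _).1 (hp _).2.1 (hp _).2.2 ⟨hx.1, ih hx⟩
  let K : ℕ → Set X := fun n => closure (p n).1 ∩ closure (p n).2
  have hK : ∀ n, IsClosed (K n) := fun n => isClosed_closure.inter isClosed_closure
  -- The points that are not covered at some stage lie in a set `D m` of controlled dimension.
  have hKD : ∀ n, ∀ x ∈ s, x ∈ K n ∪ D n (p n) → ∃ m, x ∈ D m (p m) \ K m := by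
    intro n x hxs hx
    induction n with
    | zero =>
      refine ⟨0, hx.resolve_left fun h0 => ?_, fun h0 => ?_⟩ <;>
      exact hAB.le ⟨⟨hxs, (hcl₀ h0).1⟩, (hcl₀ h0).2⟩
    | succ n ih =>
      by_cases hxK : x ∈ K (n + 1)
      · exact ih (hcl n _ (hp n).1 (hp n).2.1 (hp n).2.2 ⟨hxs, hxK⟩)
      · exact ⟨n + 1, hx.resolve_left hxK, hxK⟩
  refine ⟨(⋃ n, (p n).2)ᶜ, (⋃ n, (p n).1)ᶜ, (isOpen_iUnion fun n => (hp n).2.1).isClosed_compl,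
    (isOpen_iUnion fun n => (hp n).1).isClosed_compl, ?_, ?_, ?_, ?_⟩
  · intro x hx
    by_contra hnot
    rw [← compl_inter, mem_compl_iff, not_not] at hnot
    obtain ⟨⟨m, hm⟩, ⟨n, hn⟩⟩ := And.intro (mem_iUnion.1 hnot.1) (mem_iUnion.1 hnot.2)
    exact disjoint_left.1 (hp (max m n)).2.2 (hmono₁ (le_max_right m n) ⟨hx, hn⟩)
      (hmono₂ (le_max_left m n) ⟨hx, hm⟩)
  · refine subset_empty_iff.1 fun x hx => hx.2 (mem_iUnion.2 ⟨0, hAU ⟨hx.1.2, fun hxB => ?_⟩⟩)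
    exact hAB.le ⟨hx.1, hxB⟩
  · refine subset_empty_iff.1 fun x hx => hx.2 (mem_iUnion.2 ⟨0, hBV ⟨hx.1.2, fun hxA => ?_⟩⟩)
    exact hAB.le ⟨⟨hx.1.1, hxA⟩, hx.1.2⟩
  · choose E hE hEK using fun n => exists_isClosed_iUnion_eq (hK n).isOpen_compl
    refine hsum _ (fun i => D i.unpair.1 (p i.unpair.1) ∩ E i.unpair.1 i.unpair.2)
      (fun i => (hD _ _ (hp _).1 (hp _).2.1 (hp _).2.2).inter (hE _ _)) ?_ fun i => ?_
    · rintro x ⟨⟨hxs, hx2⟩, hx1⟩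
      obtain ⟨n, hn⟩ := mem_iUnion.1 (hcov hxs)
      obtain ⟨m, hmD, hmK⟩ := hKD n x hxs
        ((hcov' n _ (hp n).1 (hp n).2.1 (hp n).2.2 ⟨hxs, hn⟩).resolve_left fun hx => by
          rcases hx with hx | hx
          · exact hx1 (mem_iUnion.2 ⟨n + 1, hx⟩)
          · exact hx2 (mem_iUnion.2 ⟨n + 1, hx⟩))
      obtain ⟨j, hj⟩ := mem_iUnion.1 ((hEK m).ge hmK)
      exact mem_iUnion.2 ⟨Nat.pair m j, by simpa using ⟨hmD, hj⟩⟩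
    · have hEsub : E i.unpair.1 i.unpair.2 ⊆ (K i.unpair.1)ᶜ :=
        (subset_iUnion _ _).trans (hEK _).le
      refine (hDk i.unpair.1 (p i.unpair.1) (hp _).1 (hp _).2.1 (hp _).2.2).of_eq_inter
        (((isOpen_iUnion fun n => (hp n).2.1).isClosed_compl.inter
          (isOpen_iUnion fun n => (hp n).1).isClosed_compl).inter (hE i.unpair.1 i.unpair.2)) ?_
      ext x
      constructor
      · rintro ⟨⟨⟨hxs, h2⟩, h1⟩, hxD, hxE⟩
        exact ⟨⟨⟨hxs, hxD⟩, hEsub hxE⟩, ⟨h2, h1⟩, hxE⟩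
      · rintro ⟨⟨⟨hxs, hxD⟩, -⟩, ⟨h2, h1⟩, hxE⟩
        exact ⟨⟨⟨hxs, h2⟩, h1⟩, hxD, hxE⟩

/-- The countable closed sum theorem for the large inductive dimension of perfectly normal
spaces. -/
theorem indLT_of_subset_iUnion {k : ℕ} {s : Set X} {C : ℕ → Set X} (hC : ∀ i, IsClosed (C i))
    (hcov : s ⊆ ⋃ i, C i) (h : ∀ i, IndLT k (s ∩ C i)) : IndLT k s := by
  induction k generalizing s C with
  | zero =>
    refine subset_empty_iff.1 fun x hx => ?_
    obtain ⟨i, hi⟩ := mem_iUnion.1 (hcov hx)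
    exact (h i).le ⟨hx, hi⟩
  | succ k ih => exact IndLT.sum_succ (fun s C hC hcov h => ih hC hcov h) hC hcov h

theorem IndLT.inter_isOpen {k : ℕ} {s O : Set X} (h : IndLT k s) (hO : IsOpen O) :
    IndLT k (s ∩ O) := by
  obtain ⟨E, hE, rfl⟩ := exists_isClosed_iUnion_eq hO
  refine indLT_of_subset_iUnion hE inter_subset_right fun i => ?_
  rw [inter_assoc, inter_eq_self_of_subset_right (subset_iUnion E i)]
  exact h.inter_isClosed (hE i)

end PerfectlyNormal

end RingLikeResolution

/-! ### Large inductive dimension and fully closed maps -/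

namespace RingLikeResolution

section Collapse

variable {X : Type u} {Z : Type w} [TopologicalSpace X] [TopologicalSpace Z]

/-- The equivalence relation whose classes are the points of the fibres of `π` over `D`, and the
remaining fibres. -/
def collapseSetoid {X : Type u} {Z : Type w} (π : Z → X) (D : Set X) : Setoid Z where
  r z z' := z = z' ∨ π z = π z' ∧ π z ∉ D
  iseqv :=
    { refl := fun _ => Or.inl rfl
      symm := by
        rintro z z' (rfl | ⟨h, hD⟩)
        · exact Or.inl rfl
        · exact Or.inr ⟨h.symm, h ▸ hD⟩
      trans := by
        rintro z z' z'' (rfl | ⟨h, hD⟩) (rfl | ⟨h', hD'⟩)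
        · exact Or.inl rfl
        · exact Or.inr ⟨h', hD'⟩
        · exact Or.inr ⟨h, hD⟩
        · exact Or.inr ⟨h.trans h', hD⟩ }

/-- The space obtained by collapsing to points the fibres of `π` which do not lie over `D`. -/
abbrev Collapse {X : Type u} {Z : Type w} (π : Z → X) (D : Set X) : Type w :=
  Quotient (collapseSetoid π D)

theorem collapse_mk_eq_iff {X : Type u} {Z : Type w} {π : Z → X} {D : Set X} {z z' : Z} :
    (Quotient.mk _ z : Collapse π D) = Quotient.mk _ z' ↔ z = z' ∨ π z = π z' ∧ π z ∉ D :=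
  Quotient.eq

theorem isClosedMap_collapse_mk [CompactSpace Z] [T2Space Z] [T2Space X] {π : Z → X}
    (hπ : Continuous π) (hfc : IsFullyClosed π) (D : Set X) :
    IsClosedMap (Quotient.mk _ : Z → Collapse π D) := by
  intro C hC
  rw [← isQuotientMap_quotient_mk'.isClosed_preimage, ← isOpen_compl_iff, isOpen_iff_mem_nhds]
  change ∀ z ∈ ((Quotient.mk (collapseSetoid π D)) ⁻¹' (Quotient.mk _ '' C))ᶜ, _ ∈ 𝓝 z
  intro z hz
  have hsat : ∀ {w}, w ∈ (Quotient.mk (collapseSetoid π D)) ⁻¹' (Quotient.mk _ '' C) ↔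
      w ∈ C ∨ π w ∈ π '' C ∧ π w ∉ D := by
    intro w
    constructor
    · rintro ⟨c, hc, hcw⟩
      rcases collapse_mk_eq_iff.1 hcw with rfl | ⟨h, hD⟩
      · exact Or.inl hc
      · exact Or.inr ⟨⟨c, hc, h⟩, h ▸ hD⟩
    · rintro (hw | ⟨⟨c, hc, h⟩, hD⟩)
      · exact ⟨w, hw, rfl⟩
      · exact ⟨c, hc, collapse_mk_eq_iff.2 (Or.inr ⟨h, h ▸ hD⟩)⟩
  rw [mem_compl_iff, hsat, not_or] at hz
  obtain ⟨hzC, hzD⟩ := hz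
  obtain ⟨G, hG, hGc, hGC⟩ := exists_mem_nhds_isClosed_subset (hC.isOpen_compl.mem_nhds hzC)
  have hfin := hfc.finite_image_inter_image hπ hGc hC (disjoint_left.2 hGC)
  have hO : π ⁻¹' ((π '' G ∩ π '' C) \ {π z})ᶜ ∈ 𝓝 z :=
    (hfin.sdiff.isClosed.isOpen_compl.preimage hπ).mem_nhds fun h => h.2 rfl
  filter_upwards [hG, hO] with w hwG hwO
  change w ∈ ((Quotient.mk (collapseSetoid π D)) ⁻¹' (Quotient.mk _ '' C))ᶜ
  rw [mem_compl_iff, hsat, not_or]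
  refine ⟨hGC hwG, fun ⟨hwC, hwD⟩ => ?_⟩
  have hwz : π w = π z := by
    by_contra hne
    exact hwO ⟨⟨mem_image_of_mem _ hwG, hwC⟩, hne⟩
  rw [hwz] at hwC hwD
  exact hzD ⟨hwC, hwD⟩

theorem t2Space_of_isClosedMap [NormalSpace Z] [T1Space Z] {W : Type*} [TopologicalSpace W]
    {q : Z → W} (hq : Continuous q) (hqs : Function.Surjective q) (hqc : IsClosedMap q) :
    T2Space W := by
  have hsing : ∀ w : W, IsClosed {w} := hqs.forall.2 fun z => by
    simpa using hqc _ (isClosed_singleton (x := z))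
  refine ⟨fun w w' hne => ?_⟩
  obtain ⟨U, V, hU, hV, hwU, hwV, hUV⟩ := normal_separation ((hsing w).preimage hq)
    ((hsing w').preimage hq) (Disjoint.preimage q (disjoint_singleton.2 hne))
  refine ⟨kernImage q U, kernImage q V, isClosedMap_iff_kernImage.1 hqc hU,
    isClosedMap_iff_kernImage.1 hqc hV, fun z hz => hwU hz, fun z hz => hwV hz, ?_⟩
  refine disjoint_left.2 (hqs.forall.2 fun z hzU hzV => ?_)
  exact disjoint_left.1 hUV (hzU rfl) (hzV rfl)

theorem t2Space_collapse [CompactSpace Z] [T2Space Z] [T2Space X] {π : Z → X}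
    (hπ : Continuous π) (hfc : IsFullyClosed π) (D : Set X) : T2Space (Collapse π D) :=
  t2Space_of_isClosedMap continuous_quotient_mk' Quotient.mk_surjective
    (isClosedMap_collapse_mk hπ hfc D)

/-- Collapsing all but finitely many fibres gives a perfectly normal space: an open set splits
into its intersections with the remaining fibres, and an open set of the target. -/
theorem perfectlyNormalSpace_collapse [CompactSpace Z] [T2Space Z] [T2Space X]
    [PerfectlyNormalSpace X] {π : Z → X} (hπ : Continuous π) (hfc : IsFullyClosed π)
    (hfib : ∀ x, PerfectlyNormalSpace (π ⁻¹' {x} : Set Z)) {D : Set X} (hD : D.Finite) :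
    PerfectlyNormalSpace (Collapse π D) := by
  have hT2 := t2Space_collapse hπ hfc D
  refine { toNormalSpace := inferInstance, closed_gdelta := fun C hC => ?_ }
  have hqc := isClosedMap_collapse_mk hπ hfc D
  let q : Z → Collapse π D := Quotient.mk _
  have hq : Continuous q := continuous_quotient_mk'
  have hO : IsOpen (q ⁻¹' Cᶜ) := hC.isOpen_compl.preimage hq
  choose E hE hEeq using fun x => exists_isClosed_iUnion_eq
    (hO.preimage (continuous_subtype_val : Continuous (Subtype.val : (π ⁻¹' {x} : Set Z) → Z)))
  obtain ⟨F, hF, hFeq⟩ := exists_isClosed_iUnion_eq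
    ((isOpen_kernImage hπ hO).sdiff hD.isClosed)
  have hE' : ∀ x n, IsClosed (q '' (Subtype.val '' E x n)) := fun x n =>
    hqc _ ((isClosed_singleton.preimage hπ).isClosedMap_subtype_val _ (hE x n))
  have hF' : ∀ n, IsClosed (q '' (π ⁻¹' F n)) := fun n => hqc _ ((hF n).preimage hπ)
  have hCeq : C = (⋂ x ∈ D, ⋂ n, (q '' (Subtype.val '' E x n))ᶜ) ∩ ⋂ n, (q '' (π ⁻¹' F n))ᶜ := by
    ext w
    constructor
    · refine fun hw => ⟨?_, ?_⟩
      · simp only [mem_iInter, mem_compl_iff]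
        rintro x - n ⟨_, ⟨e, he, rfl⟩, rfl⟩
        exact ((hEeq x).le (mem_iUnion.2 ⟨n, he⟩)) hw
      · simp only [mem_iInter, mem_compl_iff]
        rintro n ⟨z, hz, rfl⟩
        exact (hFeq.le (mem_iUnion.2 ⟨n, hz⟩)).1 rfl hw
    · rintro ⟨h1, h2⟩
      by_contra hw
      obtain ⟨z, rfl⟩ := Quotient.mk_surjective w
      by_cases hz : π z ∈ D
      · obtain ⟨n, hn⟩ := mem_iUnion.1
          ((hEeq (π z)).ge (show (⟨z, rfl⟩ : (π ⁻¹' {π z} : Set Z)) ∈ _ from hw))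
        exact mem_iInter.1 (mem_iInter₂.1 h1 _ hz) n ⟨z, ⟨_, hn, rfl⟩, rfl⟩
      · have hker : π z ∈ kernImage π (q ⁻¹' Cᶜ) \ D := by
          refine ⟨fun z' hz' hqz' => hw ?_, hz⟩
          have : q z' = Quotient.mk _ z := collapse_mk_eq_iff.2 (Or.inr ⟨hz', hz' ▸ hz⟩)
          exact this ▸ hqz'
        obtain ⟨n, hn⟩ := mem_iUnion.1 (hFeq.ge hker)
        exact mem_iInter.1 h2 n ⟨z, hn, rfl⟩
  rw [hCeq]
  exact (IsGδ.biInter hD.countable fun x _ => .iInter fun n => (hE' x n).isOpen_compl.isGδ).inter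
    (.iInter fun n => (hF' n).isOpen_compl.isGδ)

end Collapse

section IndEstimate

variable {X : Type u} {Z : Type w} [TopologicalSpace X] [TopologicalSpace Z]

theorem indLT_of_finite_image [T1Space X] {π : Z → X} (hπ : Continuous π) {D : Set X}
    (hD : D.Finite) {k : ℕ} {T : Set Z} (hT : MapsTo π T D)
    (h : ∀ x ∈ D, IndLT k (T ∩ π ⁻¹' {x})) : IndLT k T := by
  induction k generalizing T with
  | zero => exact subset_empty_iff.1 fun z hz => (h _ (hT hz)).le ⟨hz, rfl⟩
  | succ k ih =>
    intro A B hA hB hAB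
    choose! P Q hP hQ hPQ hAQ hBP hL using fun x hx => h x hx A B hA hB
      (subset_empty_iff.1 (hAB ▸ by gcongr; exact inter_subset_left))
    have hmem : ∀ R : X → Set Z, ∀ z ∈ T, z ∈ ⋃ x ∈ D, (R x ∩ π ⁻¹' {x}) ↔ z ∈ R (π z) := by
      intro R z hz
      refine ⟨fun h => ?_, fun h => mem_biUnion (hT hz) ⟨h, rfl⟩⟩
      obtain ⟨x, -, hzR, rfl⟩ := mem_iUnion₂.1 h
      exact hzR
    have hclosed : ∀ R : X → Set Z, (∀ x ∈ D, IsClosed (R x)) →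
        IsClosed (⋃ x ∈ D, (R x ∩ π ⁻¹' {x})) := fun R hR =>
      hD.isClosed_biUnion fun x hx => (hR x hx).inter (isClosed_singleton.preimage hπ)
    refine ⟨⋃ x ∈ D, (P x ∩ π ⁻¹' {x}), ⋃ x ∈ D, (Q x ∩ π ⁻¹' {x}), hclosed P hP, hclosed Q hQ,
      fun z hz => ?_, subset_empty_iff.1 ?_, subset_empty_iff.1 ?_, ?_⟩
    · rw [mem_union, hmem P z hz, hmem Q z hz]
      exact hPQ _ (hT hz) ⟨hz, rfl⟩
    · rintro z ⟨⟨hz, hzA⟩, hzQ⟩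
      exact (hAQ _ (hT hz)).le ⟨⟨⟨hz, rfl⟩, hzA⟩, (hmem Q z hz).1 hzQ⟩
    · rintro z ⟨⟨hz, hzB⟩, hzP⟩
      exact (hBP _ (hT hz)).le ⟨⟨⟨hz, rfl⟩, hzB⟩, (hmem P z hz).1 hzP⟩
    · refine ih (fun z hz => hT hz.1.1) fun x hx => ?_
      convert hL x hx using 1
      ext z
      constructor
      · rintro ⟨⟨⟨hz, hzP⟩, hzQ⟩, rfl⟩
        exact ⟨⟨⟨hz, rfl⟩, (hmem P z hz).1 hzP⟩, (hmem Q z hz).1 hzQ⟩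
      · rintro ⟨⟨⟨hz, rfl⟩, hzP⟩, hzQ⟩
        exact ⟨⟨⟨hz, (hmem P z hz).2 hzP⟩, (hmem Q z hz).2 hzQ⟩, rfl⟩

/-- The partition in the inductive step of the dimension estimate. Let `A`, `B` be disjoint closed
subsets of `T`. The images of `A` and `B` meet in a finite set `D`. Given partitions between `A`
and `B` in the fibres over `D`, collapsing the other fibres turns the problem of extending them
into one about a perfectly normal space, which is solved with a partition in `s \ D`. -/
theorem exists_partition_of_isFullyClosed [CompactSpace Z] [T2Space Z] [T2Space X]
    [PerfectlyNormalSpace X] {π : Z → X} (hπ : Continuous π) (hfc : IsFullyClosed π)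
    (hfib : ∀ x, PerfectlyNormalSpace (π ⁻¹' {x} : Set Z)) {n m : ℕ} {s : Set X} {T : Set Z}
    (hT : IsClosed T) (hTs : MapsTo π T s) (hs : IndLT (n + 1) s)
    (h : ∀ x, IndLT (m + 1) (T ∩ π ⁻¹' {x})) {A B : Set Z} (hA : IsClosed A) (hB : IsClosed B)
    (hAB : T ∩ A ∩ B = ∅) :
    ∃ (P Q : Set Z) (D E : Set X), IsClosed P ∧ IsClosed Q ∧ T ⊆ P ∪ Q ∧ T ∩ A ∩ Q = ∅ ∧
      T ∩ B ∩ P = ∅ ∧ D.Finite ∧ E ⊆ Dᶜ ∧ IndLT n E ∧ MapsTo π (T ∩ P ∩ Q) (D ∪ E) ∧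
      ∀ x ∈ D, IndLT m (T ∩ P ∩ Q ∩ π ⁻¹' {x}) := by
  set D := π '' (T ∩ A) ∩ π '' (T ∩ B) with hDdef
  have hD : D.Finite := hfc.finite_image_inter_image hπ (hT.inter hA) (hT.inter hB)
    (disjoint_left.2 fun z h1 h2 => hAB.le ⟨h1, h2.2⟩)
  choose P₀ Q₀ hP₀ hQ₀ hPQ₀ hAQ₀ hBP₀ hL₀ using fun x => h x A B hA hB
    (subset_empty_iff.1 (hAB ▸ by gcongr; exact inter_subset_left))
  have hclosed : ∀ R : X → Set Z, (∀ x, IsClosed (R x)) →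
      IsClosed (⋃ x ∈ D, (T ∩ R x ∩ π ⁻¹' {x})) := fun R hR =>
    hD.isClosed_biUnion fun x _ => (hT.inter (hR x)).inter (isClosed_singleton.preimage hπ)
  have hmemF : ∀ {R : X → Set Z} {z : Z}, z ∈ ⋃ x ∈ D, (T ∩ R x ∩ π ⁻¹' {x}) ↔
      π z ∈ D ∧ z ∈ T ∧ z ∈ R (π z) := by
    intro R z
    refine ⟨fun h => ?_, fun h => mem_biUnion h.1 ⟨h.2, rfl⟩⟩
    obtain ⟨x, hx, hzR, rfl⟩ := mem_iUnion₂.1 h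
    exact ⟨hx, hzR⟩
  have := t2Space_collapse hπ hfc D
  have := perfectlyNormalSpace_collapse hπ hfc hfib hD
  let q : Z → Collapse π D := Quotient.mk _
  have hq : Continuous q := continuous_quotient_mk'
  have hqc : IsClosedMap q := isClosedMap_collapse_mk hπ hfc D
  -- `FP` and `FQ` are the two sides of the given partitions in the fibres over `D`.
  let FP : Set Z := ⋃ x ∈ D, (T ∩ P₀ x ∩ π ⁻¹' {x})
  let FQ : Set Z := ⋃ x ∈ D, (T ∩ Q₀ x ∩ π ⁻¹' {x})
  let A₁ : Set Z := T ∩ A ∪ FP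
  let B₁ : Set Z := T ∩ B ∪ FQ
  obtain ⟨U, V, hU, hV, hUV, hAU, hBV, hcl⟩ := exists_isOpen_closure_inter_closure_subset
    (hqc A₁ ((hT.inter hA).union (hclosed P₀ hP₀))) (hqc B₁ ((hT.inter hB).union (hclosed Q₀ hQ₀)))
  have hqD : ∀ {R : Set Z} {z : Z}, π z ∈ D → q z ∈ q '' R → z ∈ R := by
    rintro R z hz ⟨z', hz', heq⟩
    rcases collapse_mk_eq_iff.1 heq with rfl | ⟨h1, h2⟩
    · exact hz'
    · exact absurd (h1 ▸ hz) h2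
  -- Off the fibres over `D`, the images of `A₁` and `B₁` in the collapsed space are disjoint.
  have hqA : ∀ {z : Z}, π z ∉ D → q z ∈ q '' A₁ → q z ∈ q '' B₁ → False := by
    rintro z hz ⟨a, ha, haz⟩ ⟨b, hb, hbz⟩
    have haz' : π a = π z := (collapse_mk_eq_iff.1 haz).elim (congrArg π) And.left
    have hbz' : π b = π z := (collapse_mk_eq_iff.1 hbz).elim (congrArg π) And.left
    have ha' := ha.resolve_right fun h => hz (haz' ▸ (hmemF.1 h).1)
    have hb' := hb.resolve_right fun h => hz (hbz' ▸ (hmemF.1 h).1)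
    exact hz ⟨⟨a, ha', haz'⟩, ⟨b, hb', hbz'⟩⟩
  have hcompact : ∀ {R : Set (Collapse π D)}, IsClosed R → IsClosed (π '' (q ⁻¹' R)) := fun hR =>
    ((hR.preimage hq).isCompact.image hπ).isClosed
  obtain ⟨P', Q', hP', hQ', hPQ', hAQ', hBP', hL'⟩ := hs.inter_isOpen hD.isClosed.isOpen_compl _ _
    (hcompact (isClosed_closure (s := U))) (hcompact (isClosed_closure (s := V))) (by
      refine subset_empty_iff.1 ?_
      rintro x ⟨⟨⟨-, hxD⟩, ⟨z, hzU, rfl⟩⟩, ⟨z', hzV, heq⟩⟩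
      have hqz : q z' = q z := collapse_mk_eq_iff.2 (Or.inr ⟨heq, heq ▸ hxD⟩)
      rw [mem_preimage, hqz] at hzV
      exact hqA hxD (hcl ⟨hzU, hzV⟩).1 (hcl ⟨hzU, hzV⟩).2)
  -- Removing the preimage of `V` keeps the closed set `P`, over `D`, within the sets `P₀ x`.
  let P : Set Z := FP ∪ T ∩ π ⁻¹' (P' ∪ D) ∩ (q ⁻¹' V)ᶜ
  let Q : Set Z := FQ ∪ T ∩ π ⁻¹' (Q' ∪ D) ∩ (q ⁻¹' U)ᶜ
  have hPD : ∀ z ∈ T, π z ∈ D → (z ∈ P ↔ z ∈ P₀ (π z)) := by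
    refine fun z hz hzD => ⟨?_, fun h => Or.inl (hmemF.2 ⟨hzD, hz, h⟩)⟩
    rintro (h | ⟨-, hzV⟩)
    · exact (hmemF.1 h).2.2
    · by_contra hzP
      have hzQ : z ∈ Q₀ (π z) := (hPQ₀ (π z) ⟨hz, rfl⟩).resolve_left hzP
      refine hzV (hBV ⟨mem_image_of_mem _ (Or.inr (hmemF.2 ⟨hzD, hz, hzQ⟩)), fun hzA => ?_⟩)
      rcases hqD hzD hzA with hzA | hzA
      · exact (hAQ₀ (π z)).le ⟨⟨⟨hz, rfl⟩, hzA.2⟩, hzQ⟩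
      · exact hzP (hmemF.1 hzA).2.2
  have hQD : ∀ z ∈ T, π z ∈ D → (z ∈ Q ↔ z ∈ Q₀ (π z)) := by
    refine fun z hz hzD => ⟨?_, fun h => Or.inl (hmemF.2 ⟨hzD, hz, h⟩)⟩
    rintro (h | ⟨-, hzU⟩)
    · exact (hmemF.1 h).2.2
    · by_contra hzQ
      have hzP : z ∈ P₀ (π z) := (hPQ₀ (π z) ⟨hz, rfl⟩).resolve_right hzQ
      refine hzU (hAU ⟨mem_image_of_mem _ (Or.inr (hmemF.2 ⟨hzD, hz, hzP⟩)), fun hzB => ?_⟩)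
      rcases hqD hzD hzB with hzB | hzB
      · exact (hBP₀ (π z)).le ⟨⟨⟨hz, rfl⟩, hzB.2⟩, hzP⟩
      · exact hzQ (hmemF.1 hzB).2.2
  have hPoff : ∀ z ∈ T, π z ∉ D → (z ∈ P ↔ π z ∈ P') := by
    refine fun z hz hzD => ⟨?_, fun h => Or.inr ⟨⟨hz, Or.inl h⟩, fun hzV => ?_⟩⟩
    · rintro (h | ⟨⟨-, hzP⟩, -⟩)
      · exact absurd (hmemF.1 h).1 hzD
      · exact hzP.resolve_right hzD
    · exact hBP'.le ⟨⟨⟨hTs hz, hzD⟩, ⟨z, subset_closure hzV, rfl⟩⟩, h⟩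
  have hQoff : ∀ z ∈ T, π z ∉ D → (z ∈ Q ↔ π z ∈ Q') := by
    refine fun z hz hzD => ⟨?_, fun h => Or.inr ⟨⟨hz, Or.inl h⟩, fun hzU => ?_⟩⟩
    · rintro (h | ⟨⟨-, hzQ⟩, -⟩)
      · exact absurd (hmemF.1 h).1 hzD
      · exact hzQ.resolve_right hzD
    · exact hAQ'.le ⟨⟨⟨hTs hz, hzD⟩, ⟨z, subset_closure hzU, rfl⟩⟩, h⟩
  refine ⟨P, Q, D, s ∩ Dᶜ ∩ P' ∩ Q', ?_, ?_, fun z hz => ?_, subset_empty_iff.1 ?_,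
    subset_empty_iff.1 ?_, hD, fun x hx => hx.1.1.2, hL', ?_, fun x hx => ?_⟩
  · exact (hclosed P₀ hP₀).union ((hT.inter ((hP'.union hD.isClosed).preimage hπ)).inter
      (hV.preimage hq).isClosed_compl)
  · exact (hclosed Q₀ hQ₀).union ((hT.inter ((hQ'.union hD.isClosed).preimage hπ)).inter
      (hU.preimage hq).isClosed_compl)
  · by_cases hzD : π z ∈ D
    · rw [mem_union, hPD z hz hzD, hQD z hz hzD]
      exact hPQ₀ _ ⟨hz, rfl⟩
    · rw [mem_union, hPoff z hz hzD, hQoff z hz hzD]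
      exact hPQ' ⟨hTs hz, hzD⟩
  · rintro z ⟨⟨hz, hzA⟩, hzQ⟩
    by_cases hzD : π z ∈ D
    · exact (hAQ₀ _).le ⟨⟨⟨hz, rfl⟩, hzA⟩, (hQD z hz hzD).1 hzQ⟩
    · have hqz : q z ∈ q '' A₁ := mem_image_of_mem _ (Or.inl ⟨hz, hzA⟩)
      have hzU : q z ∈ U := hAU ⟨hqz, hqA hzD hqz⟩
      exact hAQ'.le ⟨⟨⟨hTs hz, hzD⟩, ⟨z, subset_closure hzU, rfl⟩⟩, (hQoff z hz hzD).1 hzQ⟩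
  · rintro z ⟨⟨hz, hzB⟩, hzP⟩
    by_cases hzD : π z ∈ D
    · exact (hBP₀ _).le ⟨⟨⟨hz, rfl⟩, hzB⟩, (hPD z hz hzD).1 hzP⟩
    · have hqz : q z ∈ q '' B₁ := mem_image_of_mem _ (Or.inl ⟨hz, hzB⟩)
      have hzV : q z ∈ V := hBV ⟨hqz, fun h => hqA hzD h hqz⟩
      exact hBP'.le ⟨⟨⟨hTs hz, hzD⟩, ⟨z, subset_closure hzV, rfl⟩⟩, (hPoff z hz hzD).1 hzP⟩
  · rintro z ⟨⟨hz, hzP⟩, hzQ⟩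
    by_cases hzD : π z ∈ D
    · exact Or.inl hzD
    · exact Or.inr ⟨⟨⟨hTs hz, hzD⟩, (hPoff z hz hzD).1 hzP⟩, (hQoff z hz hzD).1 hzQ⟩
  · convert hL₀ x using 1
    ext z
    constructor
    · rintro ⟨⟨⟨hz, hzP⟩, hzQ⟩, rfl⟩
      exact ⟨⟨⟨hz, rfl⟩, (hPD z hz hx).1 hzP⟩, (hQD z hz hx).1 hzQ⟩
    · rintro ⟨⟨⟨hz, rfl⟩, hzP⟩, hzQ⟩
      exact ⟨⟨⟨hz, (hPD z hz hx).2 hzP⟩, (hQD z hz hx).2 hzQ⟩, rfl⟩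

theorem IndLT.finite_union [T1Space X] [PerfectlyNormalSpace X] {n : ℕ} {D E : Set X}
    (hD : D.Finite) (hE : IndLT (n + 1) E) (hED : E ⊆ Dᶜ) : IndLT (n + 1) (D ∪ E) := by
  obtain ⟨F, hF, hFeq⟩ := exists_isClosed_iUnion_eq hD.isClosed.isOpen_compl
  have hFD : ∀ i, F i ⊆ Dᶜ := fun i => (subset_iUnion F i).trans hFeq.le
  refine indLT_of_subset_iUnion (C := fun i => Nat.casesOn i D F) ?_ ?_ ?_
  · rintro (_ | i)
    exacts [hD.isClosed, hF i]
  · rintro x (hx | hx)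
    · exact mem_iUnion.2 ⟨0, hx⟩
    · obtain ⟨i, hi⟩ := mem_iUnion.1 (hFeq.ge (hED hx))
      exact mem_iUnion.2 ⟨i + 1, hi⟩
  · rintro (_ | i)
    · exact (indLT_one_of_finite (hD.inter_of_right _)).mono (by omega)
    · refine hE.of_eq_inter (hF i) ?_
      show (D ∪ E) ∩ F i = _
      rw [union_inter_distrib_right, (disjoint_left.2 fun x h1 h2 => hFD i h2 h1 :
        Disjoint D (F i)).inter_eq, empty_union]

/-- The dimension estimate for the large inductive dimension. If `s` is zero-dimensional, then the
partition constructed above lies over finitely many points, and is small in each fibre. Otherwise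
its image satisfies a smaller bound on the dimension than `s`. -/
theorem indLT_of_isFullyClosed [CompactSpace Z] [T2Space Z] [T2Space X]
    [PerfectlyNormalSpace X] {π : Z → X} (hπ : Continuous π) (hfc : IsFullyClosed π)
    (hfib : ∀ x, PerfectlyNormalSpace (π ⁻¹' {x} : Set Z)) {n m : ℕ} {s : Set X} {T : Set Z}
    (hT : IsClosed T) (hTs : MapsTo π T s) (hs : IndLT n s)
    (h : ∀ x, IndLT (m + 1) (T ∩ π ⁻¹' {x})) : IndLT (n + m) T := by
  induction n generalizing s T with
  | zero =>
    obtain rfl : s = ∅ := hs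
    rw [show T = ∅ from subset_empty_iff.1 hTs]
    exact indLT_empty _
  | succ n ih =>
    rw [Nat.add_right_comm]
    intro A B hA hB hAB
    obtain ⟨P, Q, D, E, hP, hQ, hPQ, hAQ, hBP, hD, hED, hE, hL, hLD⟩ :=
      exists_partition_of_isFullyClosed hπ hfc hfib hT hTs hs h hA hB hAB
    refine ⟨P, Q, hP, hQ, hPQ, hAQ, hBP, ?_⟩
    cases n with
    | zero =>
      obtain rfl : E = ∅ := hE
      rw [union_empty] at hL
      rw [zero_add]
      exact indLT_of_finite_image hπ hD hL hLD
    | succ n =>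
      refine ih ((hT.inter hP).inter hQ) hL (hE.finite_union hD hED) fun x => ?_
      refine (h x).of_eq_inter (hP.inter hQ) ?_
      rw [inter_assoc T P Q, inter_right_comm]

theorem largeInd_le_iff {X : Type u} [TopologicalSpace X] {n : WithBot ℕ∞} :
    largeInd X ≤ n ↔ ∀ k : ℕ, n < k → LargeIndLT k X := by
  have hmem : largeInd X ∈ {n : WithBot ℕ∞ | ∀ k : ℕ, n < k → LargeIndLT k X} :=
    csInf_mem ⟨⊤, fun k hk => absurd hk not_top_lt⟩
  exact ⟨fun h k hk => hmem k (h.trans_lt hk), fun h => sInf_le h⟩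

theorem largeInd_ne_bot {X : Type u} [TopologicalSpace X] [Nonempty X] : largeInd X ≠ ⊥ := by
  intro h
  have : IsEmpty X := largeInd_le_iff.1 h.le 0 (WithBot.bot_lt_coe _)
  exact not_isEmpty_of_nonempty X this

theorem largeInd_le_add [CompactSpace Z] [T2Space Z] [T2Space X] [Nonempty X]
    [PerfectlyNormalSpace X] {π : Z → X} (hπ : Continuous π) (hsurj : Function.Surjective π)
    (hfc : IsFullyClosed π) (hfib : ∀ x, PerfectlyNormalSpace (π ⁻¹' {x} : Set Z)) :
    largeInd Z ≤ largeInd X + mapLargeInd π := by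
  have hle : ∀ x, largeInd (π ⁻¹' {x} : Set Z) ≤ mapLargeInd π := fun x =>
    le_iSup (fun x => largeInd (π ⁻¹' {x} : Set Z)) x
  obtain ⟨a, ha⟩ := WithBot.ne_bot_iff_exists.1 (largeInd_ne_bot (X := X))
  obtain ⟨b, hb⟩ : ∃ b : ℕ∞, ↑b = mapLargeInd π := by
    obtain ⟨x⟩ := ‹Nonempty X›
    obtain ⟨z, hz⟩ := hsurj x
    have : Nonempty (π ⁻¹' {x} : Set Z) := ⟨⟨z, hz⟩⟩
    exact WithBot.ne_bot_iff_exists.1 fun h =>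
      largeInd_ne_bot (le_bot_iff.1 ((hle x).trans h.le))
  rw [← ha, ← hb, ← WithBot.coe_add]
  rcases eq_or_ne (a + b) ⊤ with htop | htop
  · rw [htop]
    exact le_top
  · obtain ⟨a', rfl⟩ := ENat.ne_top_iff_exists.1 fun h : a = ⊤ => htop (by simp [h])
    obtain ⟨b', rfl⟩ := ENat.ne_top_iff_exists.1 fun h : b = ⊤ => htop (by simp [h])
    refine largeInd_le_iff.2 fun k hk => ?_
    have hk' : a' + b' + 1 ≤ k := by
      have : ((a' + b' : ℕ) : WithBot ℕ∞) < k := by exact_mod_cast hk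
      have : ((a' + b' : ℕ) : ℕ∞) < k := by exact_mod_cast this
      exact_mod_cast this
    have hX : IndLT (a' + 1) (univ : Set X) := largeIndLT_iff_indLT_univ.1
      (largeInd_le_iff.1 ha.ge (a' + 1) (by exact_mod_cast Nat.lt_succ_self a'))
    have hfibLT : ∀ x, IndLT (b' + 1) (univ ∩ π ⁻¹' {x}) := fun x => by
      rw [univ_inter, ← indLT_univ_coe_iff, ← largeIndLT_iff_indLT_univ]
      exact largeInd_le_iff.1 ((hle x).trans hb.ge) (b' + 1)
        (by exact_mod_cast Nat.lt_succ_self b')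
    rw [largeIndLT_iff_indLT_univ]
    exact (indLT_of_isFullyClosed hπ hfc hfib isClosed_univ (mapsTo_univ π univ) hX hfibLT).mono
      (by omega)

end IndEstimate

end RingLikeResolution

/-! ### Construction of the resolution -/

namespace RingLikeResolution

section Spiral

variable {E : Type*} [NormedAddCommGroup E] [NormedSpace ℝ E]

theorem joinedIn_thickening {S : Set E} (hS : IsPreconnected S) {δ : ℝ} (hδ : 0 < δ) {x y : E}
    (hx : x ∈ S) (hy : y ∈ S) : JoinedIn (Metric.thickening δ S) x y := by
  refine hS.induction₂ (fun x y => JoinedIn (Metric.thickening δ S) x y) (fun x hx => ?_)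
    (fun _ _ _ _ _ _ h₁ h₂ => h₁.trans h₂) (fun _ _ _ _ h => h.symm) hx hy
  filter_upwards [mem_nhdsWithin_of_mem_nhds (Metric.ball_mem_nhds x hδ)] with y hy
  exact JoinedIn.of_segment_subset (((convex_ball x δ).segment_subset
    (Metric.mem_ball_self hδ) hy).trans (Metric.ball_subset_thickening hx δ))

theorem continuous_extend_fract {E : Type*} [TopologicalSpace E] {e : ℤ → E}
    (γ : ∀ n, Path (e n) (e (n + 1))) : Continuous fun s : ℝ => (γ ⌊s⌋).extend (Int.fract s) := by
  have hon : ∀ n : ℤ, ContinuousOn (fun s : ℝ => (γ ⌊s⌋).extend (Int.fract s))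
      (Icc (n : ℝ) (n + 1)) := by
    intro n
    refine ContinuousOn.congr (f := fun s : ℝ => (γ n).extend (s - n))
      ((γ n).continuous_extend.comp (by fun_prop)).continuousOn fun s hs => ?_
    rcases hs.2.eq_or_lt with rfl | hlt
    · have h1 : ⌊(n : ℝ) + 1⌋ = n + 1 := by simp
      have h2 : Int.fract ((n : ℝ) + 1) = 0 := by simp
      simp only [h2, h1, Path.extend_zero, add_sub_cancel_left, Path.extend_one]
    · have h1 : ⌊s⌋ = n := Int.floor_eq_iff.2 ⟨hs.1, hlt⟩
      subst h1
      rfl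
  refine continuous_iff_continuousAt.2 fun s => ?_
  have h := (hon (⌊s⌋ - 1)).union_of_isClosed (hon ⌊s⌋) isClosed_Icc isClosed_Icc
  push_cast at h
  rw [sub_add_cancel, Icc_union_Icc_eq_Icc (by linarith) (by linarith)] at h
  exact h.continuousAt (Icc_mem_nhds (by linarith [Int.floor_le s]) (Int.lt_floor_add_one s))

/-- A path which spirals towards a compact connected set `S`: the cluster set of `p` at infinity
is `S`. It runs through a dense sequence of points of `S`, each of which is repeated infinitely
often, and the connecting paths stay in smaller and smaller neighbourhoods of `S`. -/
theorem exists_continuous_spiral {S : Set E} (hS : IsCompact S) (hSc : IsConnected S) :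
    ∃ p : ℝ → E, Continuous p ∧ (∀ ε > 0, ∃ N, ∀ s ≥ N, p s ∈ Metric.thickening ε S) ∧
      ∀ y ∈ S, ∀ W ∈ 𝓝 y, ∀ N, ∃ s ≥ N, p s ∈ W := by
  have : CompactSpace S := isCompact_iff_compactSpace.1 hS
  have : Nonempty S := hSc.nonempty.to_subtype
  obtain ⟨d, hd⟩ := TopologicalSpace.exists_dense_seq S
  -- The first components of pairs of natural numbers take each value infinitely often.
  let e : ℤ → E := fun n => d n.toNat.unpair.1
  have hj : ∀ n : ℤ, JoinedIn (Metric.thickening (1 / ((n.toNat : ℝ) + 1)) S) (e n) (e (n + 1)) :=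
    fun n => joinedIn_thickening hSc.isPreconnected Nat.one_div_pos_of_nat
      (Subtype.coe_prop _) (Subtype.coe_prop _)
  refine ⟨_, continuous_extend_fract fun n => (hj n).somePath, fun ε hε => ?_,
    fun y hy W hW N => ?_⟩
  · obtain ⟨N, hN⟩ := exists_nat_one_div_lt hε
    refine ⟨N, fun s hs => ?_⟩
    have hfl : N ≤ ⌊s⌋.toNat := by
      have : (N : ℤ) ≤ ⌊s⌋ := Int.le_floor.2 (by exact_mod_cast hs)
      omega
    have hmem : (hj ⌊s⌋).somePath.extend (Int.fract s) ∈
        Metric.thickening (1 / ((⌊s⌋.toNat : ℝ) + 1)) S := by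
      obtain ⟨t, ht⟩ := (Path.extend_range (hj ⌊s⌋).somePath).le (mem_range_self (Int.fract s))
      rw [← ht]
      exact (hj ⌊s⌋).somePath_mem t
    exact Metric.thickening_mono ((Nat.one_div_le_one_div hfl).trans hN.le) S hmem
  · obtain ⟨k, hk⟩ := hd.exists_mem_open (isOpen_interior.preimage continuous_subtype_val)
      ⟨⟨y, hy⟩, mem_interior_iff_mem_nhds.2 hW⟩
    obtain ⟨j, hjN⟩ := exists_nat_ge N
    refine ⟨((Nat.pair k j : ℕ) : ℝ), hjN.trans (Nat.cast_le.2 (Nat.right_le_pair k j)), ?_⟩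
    have h1 : ⌊((Nat.pair k j : ℕ) : ℝ)⌋ = ((Nat.pair k j : ℕ) : ℤ) := Int.floor_natCast _
    have h2 : Int.fract ((Nat.pair k j : ℕ) : ℝ) = 0 := Int.fract_natCast _
    simp only [h2, Path.extend_zero, h1, e, Int.toNat_natCast, Nat.unpair_pair]
    exact interior_subset hk

theorem isCompact_union_image_Ici {E : Type*} [PseudoMetricSpace E] {S : Set E}
    (hS : IsCompact S) {p : ℝ → E} (hp : Continuous p)
    (hpS : ∀ ε > 0, ∃ N, ∀ s ≥ N, p s ∈ Metric.thickening ε S) :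
    IsCompact (S ∪ p '' Ici 0) := by
  classical
  refine isCompact_of_finite_subcover fun {ι} U hU hcov => ?_
  obtain ⟨t₁, ht₁⟩ := hS.elim_finite_subcover U hU (subset_union_left.trans hcov)
  obtain ⟨ε, hε, hεU⟩ := hS.exists_thickening_subset_open
    (isOpen_biUnion fun i (_ : i ∈ t₁) => hU i) ht₁
  obtain ⟨N, hN⟩ := hpS ε hε
  obtain ⟨t₂, ht₂⟩ := ((isCompact_Icc (a := (0 : ℝ)) (b := N)).image hp).elim_finite_subcover U hU
    ((image_mono Icc_subset_Ici_self).trans (subset_union_right.trans hcov))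
  refine ⟨t₁ ∪ t₂, ?_⟩
  rw [Finset.set_biUnion_union]
  rintro _ (hx | ⟨s, hs, rfl⟩)
  · exact Or.inl (ht₁ hx)
  · rcases le_total s N with hsN | hsN
    · exact Or.inr (ht₂ ⟨s, ⟨hs, hsN⟩, rfl⟩)
    · exact Or.inl (hεU (hN s hsN))

end Spiral

section Resolution

variable {X : Type u} [TopologicalSpace X] {Q : Type*} [TopologicalSpace Q]

/-- The graph of `h` outside `x`, completed by the fibre `S` over `x`. -/
def blowUp {X : Type u} {Q : Type*} (x : X) (S : Set Q) (h : X → Q) : Set (X × Q) :=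
  {a | a.1 ≠ x ∧ a.2 = h a.1 ∨ a.1 = x ∧ a.2 ∈ S}

/-- The map `h` on the complement of `x` can be used to replace the point `x` by the set `S`:
replacing `x` in this way gives a compact space, and each point of `S` is approximated by the
values of `h` on the boundaries of arbitrarily small neighbourhoods of `x`. -/
structure IsResolvingMap (x : X) (S : Set Q) (h : X → Q) : Prop where
  isClosed_blowUp : IsClosed (blowUp x S h)
  exists_isCompact : ∃ K, IsCompact K ∧ ∀ a ∈ blowUp x S h, a.2 ∈ K
  exists_frontier : ∀ V ∈ 𝓝 x, ∀ y ∈ S, ∀ W ∈ 𝓝 y, ∃ V' : Set X, IsOpen V' ∧ x ∈ V' ∧ V' ⊆ V ∧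
    ∀ a ∈ frontier V', a ∈ V ∧ a ≠ x ∧ h a ∈ W

theorem exists_continuous_eq_zero_iff [CompactSpace X] [T2Space X] [FirstCountableTopology X]
    (x : X) : ∃ g : C(X, ℝ), (∀ a, 0 ≤ g a) ∧ ∀ a, g a = 0 ↔ a = x := by
  obtain ⟨f, hf, -, -, hf01⟩ := exists_continuous_one_zero_of_isCompact_of_isGδ
    (isCompact_singleton (x := x)) (IsGδ.singleton x) isClosed_empty (disjoint_empty _)
  refine ⟨1 - f, fun a => sub_nonneg.2 (hf01 a).2, fun a => ?_⟩
  have : a = x ↔ f a = 1 := by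
    rw [← mem_singleton_iff, hf]
    rfl
  rw [this, ContinuousMap.sub_apply, ContinuousMap.one_apply, sub_eq_zero, eq_comm]

theorem exists_isResolvingMap [CompactSpace X] [T2Space X] [FirstCountableTopology X]
    {E : Type*} [NormedAddCommGroup E] [NormedSpace ℝ E] (x : X) {S : Set E}
    (hS : IsCompact S) (hSc : IsConnected S) : ∃ h : X → E, IsResolvingMap x S h := by
  obtain ⟨p, hp, hpS, hpcl⟩ := exists_continuous_spiral hS hSc
  obtain ⟨g, hg0, hgx⟩ := exists_continuous_eq_zero_iff x
  have hgpos : ∀ {a}, a ≠ x → 0 < g a := fun {a} ha =>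
    (hg0 a).lt_of_ne' fun h => ha ((hgx a).1 h)
  have hcont : ∀ a, a ≠ x → ContinuousAt (fun a => p (1 / g a)) a := fun a ha =>
    hp.continuousAt.comp (continuousAt_const.div g.continuous.continuousAt (hgpos ha).ne')
  refine ⟨fun a => p (1 / g a), ?_, ⟨S ∪ p '' Ici 0, isCompact_union_image_Ici hS hp hpS, ?_⟩, ?_⟩
  · rw [← isOpen_compl_iff, isOpen_iff_mem_nhds]
    rintro ⟨a, q⟩ hmem
    rcases ne_or_eq a x with hax | rfl
    · have hne : p (1 / g a) ≠ q := fun h => hmem (Or.inl ⟨hax, h.symm⟩)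
      have h1 : ∀ᶠ b : X × E in 𝓝 (a, q), b.1 ≠ x := continuousAt_fst.eventually_ne hax
      have h2 : ∀ᶠ b : X × E in 𝓝 (a, q), p (1 / g b.1) ≠ b.2 :=
        (((hcont a hax).tendsto.comp
          (continuous_fst.tendsto (a, q) : Filter.Tendsto Prod.fst _ (𝓝 a))).prodMk_nhds
          (continuous_snd.tendsto (a, q))).eventually (isClosed_diagonal.isOpen_compl.mem_nhds hne)
      filter_upwards [h1, h2] with b hb1 hb2
      rintro (h | h)
      exacts [hb2 h.2.symm, hb1 h.1]
    · have hqS : q ∉ S := fun h => hmem (Or.inr ⟨rfl, h⟩)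
      obtain ⟨δ, hδ, hdisj⟩ := (disjoint_singleton_right.2 hqS).exists_thickenings hS
        isClosed_singleton
      rw [Metric.thickening_singleton] at hdisj
      obtain ⟨N, hN⟩ := hpS δ hδ
      have h1 : ∀ᶠ b : X × E in 𝓝 (a, q), g b.1 * N < 1 :=
        ((g.continuous.comp continuous_fst).mul continuous_const).continuousAt.eventually_lt
          continuousAt_const (by simp [(hgx a).2 rfl])
      have h2 : ∀ᶠ b : X × E in 𝓝 (a, q), b.2 ∈ Metric.ball q δ :=
        continuousAt_snd.eventually_mem (Metric.ball_mem_nhds q hδ)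
      filter_upwards [h1, h2] with b hb1 hb2
      rintro (⟨hne, h⟩ | ⟨-, h⟩)
      · refine disjoint_left.1 hdisj (hN (1 / g b.1) ?_)
          ((show b.2 = p (1 / g b.1) from h) ▸ hb2)
        rw [ge_iff_le, le_div_iff₀ (hgpos hne), mul_comm]
        exact hb1.le
      · exact disjoint_left.1 hdisj (Metric.self_subset_thickening hδ S h) hb2
  · rintro ⟨a, q⟩ (⟨-, h⟩ | ⟨-, h⟩)
    · exact Or.inr ⟨1 / g a, one_div_nonneg.2 (hg0 a), h.symm⟩
    · exact Or.inl h
  · intro V hV y hy W hW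
    have hnhds : Filter.comap g (𝓝 0) = 𝓝 x := by
      rw [g.continuous.isClosedMap.comap_nhds_eq g.continuous,
        show g ⁻¹' {0} = {x} from Set.ext hgx, nhdsSet_singleton]
    obtain ⟨t₀, ht₀, hball⟩ := (Metric.nhds_basis_ball.comap g).mem_iff.1 (hnhds ▸ hV)
    have hltV : ∀ a, g a < t₀ → a ∈ V := fun a ha =>
      hball (by simpa [abs_of_nonneg (hg0 a)] using ha)
    obtain ⟨s, hs, hsW⟩ := hpcl y hy W hW (1 / t₀ + 1)
    have hspos : 0 < s := by linarith [one_div_pos.2 ht₀]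
    have hst : 1 / s < t₀ := by
      rw [one_div_lt hspos ht₀]
      linarith
    refine ⟨{a | g a < 1 / s}, isOpen_lt g.continuous continuous_const, ?_,
      fun a ha => hltV a (lt_trans ha hst), fun a ha => ?_⟩
    · show g x < 1 / s
      rw [(hgx x).2 rfl]
      positivity
    · have hga : g a = 1 / s := frontier_lt_subset_eq g.continuous continuous_const ha
      refine ⟨hltV a (hga ▸ hst), fun h => ?_, ?_⟩
      · rw [(hgx a).2 h] at hga
        exact (one_div_pos.2 hspos).ne hga
      · show p (1 / g a) ∈ W
        rwa [hga, one_div_one_div]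

/-- The resolution of `X`, in which each point `x` is replaced by the set `S x` by means of the map
`h x`. It consists of the pairs of a point `a` of `X` and a family whose coordinate at `x` is
`h x a` if `x ≠ a`, and is a point of `S a` if `x = a`. -/
def resolution {X : Type u} {Q : Type*} (S : X → Set Q) (h : X → X → Q) : Set (X × (X → Q)) :=
  {z | ∀ x, (z.1, z.2 x) ∈ blowUp x (S x) (h x)}

variable {S : X → Set Q} {h : X → X → Q}

theorem resolution_apply_of_ne {X : Type u} {Q : Type*} {S : X → Set Q} {h : X → X → Q}
    {z : X × (X → Q)} (hz : z ∈ resolution S h) {x : X} (hx : z.1 ≠ x) : z.2 x = h x z.1 :=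
  (hz x).elim And.right fun h => absurd h.1 hx

theorem resolution_apply_mem {X : Type u} {Q : Type*} {S : X → Set Q} {h : X → X → Q}
    {z : X × (X → Q)} (hz : z ∈ resolution S h) : z.2 z.1 ∈ S z.1 :=
  (hz z.1).elim (fun h => absurd rfl h.1) And.right

theorem isCompact_resolution [CompactSpace X] (hh : ∀ x, IsResolvingMap x (S x) (h x)) :
    IsCompact (resolution S h) := by
  choose K hK hKmem using fun x => (hh x).exists_isCompact
  have hcl : IsClosed (resolution S h) := by
    rw [resolution, ofPred_forall]
    exact isClosed_iInter fun x => (hh x).isClosed_blowUp.preimage (by fun_prop)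
  refine IsCompact.of_isClosed_subset (isCompact_univ.prod (isCompact_univ_pi hK)) hcl ?_
  exact fun z hz => ⟨trivial, fun x _ => hKmem x _ (hz x)⟩

/-- The projection of the resolution, together with one coordinate. -/
def resolutionEval {X : Type u} {Q : Type*} (S : X → Set Q) (h : X → X → Q) (x : X)
    (z : resolution S h) : X × Q :=
  (z.1.1, z.1.2 x)

theorem continuous_resolutionEval (x : X) : Continuous (resolutionEval S h x) := by
  unfold resolutionEval
  fun_prop

theorem resolutionEval_eq_iff {X : Type u} {Q : Type*} {S : X → Set Q} {h : X → X → Q}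
    {x : X} {z z' : resolution S h} (hz : z.1.1 = x) :
    resolutionEval S h x z' = resolutionEval S h x z ↔ z' = z := by
  refine ⟨fun heq => ?_, fun heq => heq ▸ rfl⟩
  have h1 : z'.1.1 = z.1.1 := (Prod.ext_iff.1 heq).1
  have h2 : z'.1.2 x = z.1.2 x := (Prod.ext_iff.1 heq).2
  refine Subtype.ext (Prod.ext h1 (funext fun x' => ?_))
  rcases eq_or_ne z.1.1 x' with rfl | hne
  · rw [hz, h2]
  · rw [resolution_apply_of_ne z.2 hne, resolution_apply_of_ne z'.2 (h1 ▸ hne), h1]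

/-- Near a point over `a`, the topology of the resolution is determined by the projection and the
coordinate with index `a`. -/
theorem nhds_resolution [CompactSpace X] [T2Space X] [T2Space Q]
    (hh : ∀ x, IsResolvingMap x (S x) (h x)) (z : resolution S h) :
    𝓝 z = Filter.comap (resolutionEval S h z.1.1) (𝓝 (resolutionEval S h z.1.1 z)) := by
  have : CompactSpace (resolution S h) := isCompact_iff_compactSpace.1 (isCompact_resolution hh)
  have hc := continuous_resolutionEval (S := S) (h := h) z.1.1
  rw [hc.isClosedMap.comap_nhds_eq hc, show resolutionEval S h z.1.1 ⁻¹'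
    {resolutionEval S h z.1.1 z} = {z} from Set.ext fun z' => resolutionEval_eq_iff rfl,
    nhdsSet_singleton]

theorem isRingLike_resolution [CompactSpace X] [T2Space X] [T2Space Q]
    (hh : ∀ x, IsResolvingMap x (S x) (h x)) :
    IsRingLike fun z : resolution S h => z.1.1 := by
  intro z U V hU hzU hV hzV
  have hUn := hU.mem_nhds hzU
  rw [nhds_resolution hh z] at hUn
  obtain ⟨R, hR, hRU⟩ := Filter.mem_comap.1 hUn
  obtain ⟨V₁, hV₁, W, hW, hVW⟩ := mem_nhds_prod_iff.1 hR
  obtain ⟨V', hV', hzV', hV'V, hfr⟩ := (hh z.1.1).exists_frontier (V ∩ V₁)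
    (Filter.inter_mem (hV.mem_nhds hzV) hV₁) _ (resolution_apply_mem z.2) W hW
  refine ⟨V', hV', hzV', hV'V.trans inter_subset_left, fun a ha => hRU (hVW ⟨?_, ?_⟩)⟩
  · exact (hfr _ ha).1.2
  · show a.1.2 z.1.1 ∈ W
    rw [resolution_apply_of_ne a.2 (hfr _ ha).2.1]
    exact (hfr _ ha).2.2

theorem isFullyClosed_resolution [CompactSpace X] [T2Space X] [T2Space Q]
    (hh : ∀ x, IsResolvingMap x (S x) (h x)) :
    IsFullyClosed fun z : resolution S h => z.1.1 := by
  have : CompactSpace (resolution S h) := isCompact_iff_compactSpace.1 (isCompact_resolution hh)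
  intro F G hF hG hFG
  refine IsDiscrete.of_nhdsWithin fun x _ => ?_
  have hc := continuous_resolutionEval (S := S) (h := h) x
  let K : Set (X × Q) := resolutionEval S h x '' F ∩ resolutionEval S h x '' G
  have hK : IsClosed (Prod.fst '' K) :=
    (((hF.isCompact.image hc).inter (hG.isCompact.image hc)).image continuous_fst).isClosed
  have hxK : x ∉ Prod.fst '' K := by
    rintro ⟨_, ⟨⟨f, hf, rfl⟩, ⟨g, hg, hfg⟩⟩, hx⟩
    obtain rfl := (resolutionEval_eq_iff (z := f) (z' := g) hx).1 hfg
    exact disjoint_left.1 hFG hf hg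
  rw [Filter.le_pure_iff]
  filter_upwards [mem_nhdsWithin_of_mem_nhds (hK.isOpen_compl.mem_nhds hxK),
    self_mem_nhdsWithin] with a haK ha
  by_contra hne
  obtain ⟨⟨f, hf, hfa⟩, ⟨g, hg, hga⟩⟩ := ha
  have key : ∀ z : resolution S h, z.1.1 = a → resolutionEval S h x z = (a, h x a) := by
    rintro z rfl
    exact Prod.ext rfl (resolution_apply_of_ne z.2 hne)
  exact haK ⟨(a, h x a), ⟨⟨f, hf, key f hfa⟩, ⟨g, hg, key g hga⟩⟩, rfl⟩

theorem nonempty_homeomorph_fibre_resolution [CompactSpace X] [T2Space X] [T2Space Q]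
    {x : X} {Y : Type v} [TopologicalSpace Y] [CompactSpace Y] {ι : Y → Q} (hι : IsEmbedding ι)
    (hS : range ι = S x) :
    Nonempty (((fun z : resolution S h => z.1.1) ⁻¹' {x} : Set (resolution S h)) ≃ₜ Y) := by
  classical
  let f : Y → X × (X → Q) := fun y => (x, Function.update (fun a => h a x) x (ι y))
  have hf : ∀ y, f y ∈ resolution S h := by
    intro y a
    rcases eq_or_ne x a with rfl | hne
    · refine Or.inr ⟨rfl, ?_⟩
      simp only [f, Function.update_self]
      exact hS ▸ mem_range_self y
    · refine Or.inl ⟨hne, ?_⟩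
      simp only [f, Function.update_of_ne hne.symm]
  let F : Y → ((fun z : resolution S h => z.1.1) ⁻¹' {x} : Set (resolution S h)) :=
    fun y => ⟨⟨f y, hf y⟩, rfl⟩
  have hFc : Continuous F := ((continuous_const.prodMk
    (continuous_const.update x hι.continuous)).subtype_mk hf).subtype_mk _
  have hFb : Function.Bijective F := by
    constructor
    · intro y y' hyy
      have : f y = f y' := congrArg (fun z => z.1.1) hyy
      have := congrFun (congrArg Prod.snd this) x
      simp only [f, Function.update_self] at this
      exact hι.injective this
    · rintro ⟨z, hz⟩
      obtain ⟨y, hy⟩ := hS.ge (show z.1.2 x ∈ S x from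
        (show z.1.1 = x from hz) ▸ resolution_apply_mem z.2)
      refine ⟨y, Subtype.ext ((resolutionEval_eq_iff (x := x) hz).1 ?_)⟩
      refine Prod.ext (Eq.symm hz) ?_
      show Function.update (fun a => h a x) x (ι y) x = _
      rw [Function.update_self, hy]
      rfl
  exact ⟨((isHomeomorph_iff_continuous_bijective.2 ⟨hFc, hFb⟩).homeomorph F).symm⟩

end Resolution

theorem connectedSpace_of_fibres {X : Type u} {Z : Type w} [TopologicalSpace X]
    [TopologicalSpace Z] [CompactSpace X] [CompactSpace Z] [T2Space X] [ConnectedSpace X]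
    {π : Z → X} (hπ : Continuous π) (hfib : ∀ x, IsConnected (π ⁻¹' {x})) : ConnectedSpace Z :=
  connectedSpace_iff_univ.2 (IsContinuum.preimage (A := univ) hπ hfib
    ⟨isCompact_univ, isConnected_univ⟩).2

theorem isConnected_fibre {X : Type u} {Y : Type v} {Z : Type w} [TopologicalSpace Y]
    [TopologicalSpace Z] [ConnectedSpace Y] {π : Z → X} {x : X}
    (φ : (π ⁻¹' {x} : Set Z) ≃ₜ Y) : IsConnected (π ⁻¹' {x}) :=
  isConnected_iff_connectedSpace.2 (φ.symm.surjective.connectedSpace φ.symm.continuous)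

theorem exists_resolution (X : Type u) [TopologicalSpace X] [CompactSpace X] [T2Space X]
    [ConnectedSpace X] [FirstCountableTopology X]
    (Y : X → Type v) [∀ x, TopologicalSpace (Y x)] [∀ x, CompactSpace (Y x)]
    [∀ x, ConnectedSpace (Y x)] [∀ x, TopologicalSpace.MetrizableSpace (Y x)] :
    ∃ (Z : Type u) (_ : TopologicalSpace Z), CompactSpace Z ∧ T2Space Z ∧ ConnectedSpace Z ∧
      FirstCountableTopology Z ∧
      ∃ π : Z → X, Continuous π ∧ (∀ x, Nonempty ((π ⁻¹' {x} : Set Z) ≃ₜ Y x)) ∧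
        IsRingLike π ∧ IsFullyClosed π := by
  have hι : ∀ x, ∃ ι : Y x → BoundedContinuousFunction ℕ ℝ, IsEmbedding ι := fun x => by
    let _ := TopologicalSpace.metrizableSpaceMetric (Y x)
    exact TopologicalSpace.exists_embedding_l_infty (Y x)
  choose ι hι using hι
  choose h hh using fun x => exists_isResolvingMap x (isCompact_range (hι x).continuous)
    (isConnected_range (hι x).continuous)
  have hcompact : CompactSpace (resolution (fun x => range (ι x)) h) :=
    isCompact_iff_compactSpace.1 (isCompact_resolution hh)
  have hπ : Continuous fun z : resolution (fun x => range (ι x)) h => z.1.1 := by fun_prop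
  have hfib := fun x => nonempty_homeomorph_fibre_resolution (h := h)
    (S := fun x => range (ι x)) (hι x) rfl
  refine ⟨resolution (fun x => range (ι x)) h, inferInstance, hcompact, inferInstance,
    connectedSpace_of_fibres hπ fun x => isConnected_fibre (hfib x).some, ⟨fun z => ?_⟩, _, hπ,
    hfib, isRingLike_resolution hh, isFullyClosed_resolution hh⟩
  rw [nhds_resolution hh z]
  infer_instance

end RingLikeResolution

/-! ### Existence and properties of ring-like resolutions -/

theorem mainTheorem7
    (X : Type u) [TopologicalSpace X] [CompactSpace X] [T2Space X] [ConnectedSpace X]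
    [FirstCountableTopology X]
    (Y : X → Type v) [∀ x, TopologicalSpace (Y x)] [∀ x, CompactSpace (Y x)]
    [∀ x, ConnectedSpace (Y x)] [∀ x, TopologicalSpace.MetrizableSpace (Y x)] :
    (∃ (Z : Type u) (_ : TopologicalSpace Z), CompactSpace Z ∧ T2Space Z ∧ ConnectedSpace Z ∧
      FirstCountableTopology Z ∧
      ∃ π : Z → X, Continuous π ∧ (∀ x, Nonempty ((π ⁻¹' {x} : Set Z) ≃ₜ Y x)) ∧
        RingLikeResolution.IsRingLike π ∧ RingLikeResolution.IsFullyClosed π) ∧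
    (∀ (Z : Type w) [TopologicalSpace Z] [CompactSpace Z] [T2Space Z] [ConnectedSpace Z]
      (π : Z → X), Continuous π → (∀ x, Nonempty ((π ⁻¹' {x} : Set Z) ≃ₜ Y x)) →
      RingLikeResolution.IsRingLike π → RingLikeResolution.IsFullyClosed π →
        RingLikeResolution.coveringDim Z =
          max (RingLikeResolution.coveringDim X) (RingLikeResolution.mapCoveringDim π) ∧
        (PerfectlyNormalSpace X → RingLikeResolution.largeInd Z ≤
          RingLikeResolution.largeInd X + RingLikeResolution.mapLargeInd π) ∧
        (TopologicalSpace.SeparableSpace X → TopologicalSpace.SeparableSpace Z) ∧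
        ((∀ x, Nontrivial (Y x)) → ∀ P : Set Z, RingLikeResolution.IsContinuum P →
          TopologicalSpace.MetrizableSpace P → ∃ x, π '' P = {x}) ∧
        (RingLikeResolution.HereditarilyIndecomposable X →
          (∀ x, RingLikeResolution.HereditarilyIndecomposable (Y x)) →
          RingLikeResolution.HereditarilyIndecomposable Z) ∧
        (RingLikeResolution.HereditarilyDecomposable X →
          (∀ x, RingLikeResolution.HereditarilyDecomposable (Y x)) →
          RingLikeResolution.HereditarilyDecomposable Z)) := by
  refine ⟨RingLikeResolution.exists_resolution X Y, ?_⟩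
  intro Z _ _ _ _ π hπ hY hr hfc
  have hfib : ∀ x, IsConnected (π ⁻¹' {x}) := fun x =>
    RingLikeResolution.isConnected_fibre (hY x).some
  have hsurj : Function.Surjective π := fun x => (hfib x).nonempty
  refine ⟨RingLikeResolution.coveringDim_eq_max hπ hsurj hr hfc, fun _ => ?_, fun _ => ?_,
    fun hnt P hP _ => ?_, ?_, ?_⟩
  · refine RingLikeResolution.largeInd_le_add hπ hsurj hfc fun x => ?_
    have := (hY x).some.isEmbedding.metrizableSpace
    infer_instance
  · refine hr.separableSpace hπ hsurj fun x => ?_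
    let _ := TopologicalSpace.metrizableSpaceMetric (Y x)
    exact (hY x).some.symm.surjective.denseRange.separableSpace (hY x).some.symm.continuous
  · refine RingLikeResolution.exists_image_eq_singleton_of_metrizable hπ (fun x => ?_) hr hfc hP
    have := (hY x).some.symm.injective.nontrivial
    exact nontrivial_coe_sort.1 this
  · exact RingLikeResolution.hereditarilyIndecomposable_of_isRingLike hπ
      (fun x => (hY x).some) hr
  · exact RingLikeResolution.hereditarilyDecomposable_of_isRingLike hπ
      (fun x => (hY x).some) hfib hr
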